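/- Let $b>0$ and $\alpha>-1$ be real, and let $m\in\mathbb{C}$ with $\operatorname{Re} m>-1$ and $\alpha+\operatorname{Re} m>-1$. Let $J_m$ be the Bessel function of the first kind of order $m$. For $\omega\ge 1$ and $f:[0,b]\to\mathbb{C}$ put $$I_1[f]=\int_0^b x^\alpha f(x)J_m(\omega x)\,dx .$$ For an integer $N\ge 1$ let $P_Nf$ be the polynomial of degree at most $N$ that interpolates $f$ at the Clenshaw–Curtis points $x_k=\frac b2+\frac b2\cos\frac{k\pi}{N}$, $k=0,\dots,N$, and let the Clenshaw–Curtis–Filon rule be $$I_1^{CCF}[f]=\int_0^b x^\alpha P_Nf(x)J_m(\omega x)\,dx .$$ Write $\|g\|_\infty=\sup_{x\in[0,b]}|g(x)|$. **Theorem 3.1.** There is a constant $c>0$, depending only on $b,\alpha,m$, such that with $$C_1(\omega)=\begin{cases} c\,\omega^{-(\alpha+1)}, & -1<\alpha<0,\\ c\,\omega^{-1}, & \alpha\ge 0,\end{cases}$$ the following holds for every integer $N\ge1$, every $\omega\ge1$ and every $f\in C^2[0,b]$. Let $$B_1=\frac{b^{\alpha+1}}{\alpha+1}\|f-P_Nf\|_\infty,\qquad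 B_2=b\,C_1(\omega)\,\|f'-P_N'f\|_\infty,$$ $$B_3=\frac{C_1(\omega)}{\omega}\Bigl[\,|f'(b)-P_N'f(b)|+b\bigl(1+\tfrac32|\alpha-m-1|\bigr)\|f''-P_N''f\|_\infty\Bigr].$$ If $m$ is real and $m\ge0$, then $$\bigl|I_1[f]-I_1^{CCF}[f]\bigr|\le\min\{B_1,B_2,B_3\}.$$ For every $m$ as above (not necessarily real), $$\bigl|I_1[f]-I_1^{CCF}[f]\bigr|\le\min\{B_2,B_3\}.$$ -/

import Mathlib

namespace CCF

open Polynomial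

noncomputable section

/-- Bessel function of the first kind of complex order `m`,
`J_m(z) = (z/2)^m ∑ₖ (-1)^k (z/2)^(2k) / (k! Γ(m+k+1))` (principal branch of the power). -/
def besselJ (m z : ℂ) : ℂ :=
  (z / 2) ^ m *
    ∑' k : ℕ, (-1) ^ k / ((k.factorial : ℂ) * Complex.Gamma (m + k + 1)) * (z / 2) ^ (2 * k)

/-- Clenshaw-Curtis points on `[0, b]`: `x_k = b/2 + (b/2) cos (kπ/N)`, `k = 0, ..., N`. -/
def node (b : ℝ) (N k : ℕ) : ℝ :=
  b / 2 + b / 2 * Real.cos (k * Real.pi / N)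

/-- The polynomial `P_N f` of degree at most `N` interpolating `f` at the `N + 1`
Clenshaw-Curtis points of `[0, b]`. -/
def interp (b : ℝ) (N : ℕ) (f : ℝ → ℂ) : ℂ[X] :=
  Lagrange.interpolate (Finset.range (N + 1)) (fun k => (node b N k : ℂ)) (fun k => f (node b N k))

/-- The Bessel transform `I₁[f] = ∫₀ᵇ x^α f(x) J_m(ω x) dx`. -/
def besselTransform (b α : ℝ) (m : ℂ) (ω : ℝ) (f : ℝ → ℂ) : ℂ :=
  ∫ x in (0 : ℝ)..b, ((x ^ α : ℝ) : ℂ) * f x * besselJ m ((ω * x : ℝ) : ℂ)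

/-- The Clenshaw-Curtis-Filon rule for `I₁[f]`: `f` is replaced by `P_N f`. -/
def ccfRule (b α : ℝ) (m : ℂ) (ω : ℝ) (N : ℕ) (f : ℝ → ℂ) : ℂ :=
  besselTransform b α m ω (fun x => (interp b N f).eval (x : ℂ))

/-- The `j`-th derivative of `f - P_N f` at a point `x` of `[0, b]`
(one-sided derivatives of `f` at the end points). -/
def errDeriv (b : ℝ) (N : ℕ) (f : ℝ → ℂ) (j : ℕ) (x : ℝ) : ℂ :=
  iteratedDerivWithin j f (Set.Icc 0 b) x - (derivative^[j] (interp b N f)).eval (x : ℂ)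

/-- The maximum norm on `[0, b]`. -/
def supNorm (b : ℝ) (g : ℝ → ℂ) : ℝ :=
  ⨆ x : Set.Icc (0 : ℝ) b, ‖g x‖

/-- `C₁(ω) = c / ω^(α+1)` if `α < 0`, and `C₁(ω) = c / ω` if `0 ≤ α`. -/
def C₁ (c α ω : ℝ) : ℝ :=
  if α < 0 then c / ω ^ (α + 1) else c / ω

/-- First bound: `b^(α+1) / (α+1) * ‖f - P_N f‖_∞`. -/
def bound₁ (b α : ℝ) (N : ℕ) (f : ℝ → ℂ) : ℝ :=
  b ^ (α + 1) / (α + 1) * supNorm b (errDeriv b N f 0)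

/-- Second bound: `b C₁(ω) ‖f' - P_N' f‖_∞`. -/
def bound₂ (c b α ω : ℝ) (N : ℕ) (f : ℝ → ℂ) : ℝ :=
  b * C₁ c α ω * supNorm b (errDeriv b N f 1)

/-- Third bound:
`C₁(ω)/ω [ |f'(b) - P_N' f(b)| + b (1 + (3/2) |α - m - 1|) ‖f'' - P_N'' f‖_∞ ]`. -/
def bound₃ (c b α : ℝ) (m : ℂ) (ω : ℝ) (N : ℕ) (f : ℝ → ℂ) : ℝ :=
  C₁ c α ω / ω *
    (‖errDeriv b N f 1 b‖ +
      b * (1 + 3 / 2 * ‖(α : ℂ) - m - 1‖) * supNorm b (errDeriv b N f 2))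

end

end CCF

namespace CCF

open Complex Set Filter Topology MeasureTheory

/-! The error is `∫ e w` with `e = f - P_N f` and `w(x) = x^α J_m(ωx)`, and `e` vanishes at both
ends because `0` and `b` are nodes.

B₁ rests on `|J_ν| ≤ 1` on the positive axis for real `ν ≥ 0` (`norm_besselJ_le_one`). Integer
orders follow from Bessel's integral. Neumann's formula writes `J_ν(x)^2` as the mean of
`J_{2ν}(2x√t)` against the arcsine law on `[0,1]`, so the bound passes from `2ν` to `ν`, hence to
all dyadic orders, and then to all `ν ≥ 0` by continuity in the order.

B₂ is one integration by parts against the primitive of `w`, which is at most `C₁(ω)` on `[0,b]`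
(`exists_norm_integral_le_C₁`). By scaling this reduces to `∫₀^X s^α J_m(s) ds = O(1 + X^α)` for `X
≥ 1`, a consequence of the boundedness of `J_{m+1}` on `[1,∞)`, which comes from an energy estimate
for Bessel's equation.

B₃ gains the extra `1/ω` from `(x^α J_{m+1}(ωx))' = ω x^α J_m(ωx) + (α-m-1) x^(α-1) J_{m+1}(ωx)`. It
turns `ω ∫ e w` into minus the integral of `e' + (α-m-1) e/x` against the weight of order `m+1`
(`mul_integral_rpow_mul_besselJ`), to which the B₂ argument applies; the derivative of `e/x` is
controlled by `e''`. -/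

/-! ### Power series, derivatives and recurrence of `J_m`. -/

/-- The entire function `∑ₖ (-z)^k / (k! Γ(m+k+1))`, the power series part of `besselJ`. -/
noncomputable def besselSeries (m z : ℂ) : ℂ :=
  ∑' k : ℕ, (-1) ^ k / ((k.factorial : ℂ) * Gamma (m + k + 1)) * z ^ k

theorem besselJ_eq (m z : ℂ) : besselJ m z = (z / 2) ^ m * besselSeries m ((z / 2) ^ 2) := by
  simp only [besselJ, besselSeries, pow_mul]

/-- From `1/Γ(s) = s/Γ(s+1)` with `s = m+k+1`, the norms decrease once `Re s ≥ 1`, that is from `k =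
1` on. At `k = 0` only `Re s > 0` is known, hence the two starting values. -/
theorem norm_inv_Gamma_le {m : ℂ} (hm : -1 < m.re) (k : ℕ) :
    ‖(Gamma (m + k + 1))⁻¹‖ ≤ ‖(Gamma (m + 1))⁻¹‖ + ‖(Gamma (m + 2))⁻¹‖ := by
  induction k with
  | zero => simp
  | succ k ih =>
    rcases k.eq_zero_or_pos with rfl | hk
    · have h : m + ((0 + 1 : ℕ) : ℂ) + 1 = m + 2 := by push_cast; ring
      rw [h]
      exact le_add_of_nonneg_left (norm_nonneg _)
    · refine le_trans ?_ ih
      rw [one_div_Gamma_eq_self_mul_one_div_Gamma_add_one (m + k + 1), norm_mul]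
      have h1 : m + ((k + 1 : ℕ) : ℂ) + 1 = m + k + 1 + 1 := by push_cast; ring
      rw [h1]
      refine le_mul_of_one_le_left (norm_nonneg _) ?_
      have h2 : (1 : ℝ) ≤ k := by exact_mod_cast hk
      calc (1 : ℝ) ≤ (m + k + 1).re := by simp; linarith
        _ ≤ _ := re_le_norm _

theorem norm_besselSeries_coeff_le {m : ℂ} (hm : -1 < m.re) (k : ℕ) :
    ‖(-1) ^ k / ((k.factorial : ℂ) * Gamma (m + k + 1))‖ ≤
      (‖(Gamma (m + 1))⁻¹‖ + ‖(Gamma (m + 2))⁻¹‖) / k.factorial := by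
  have h := norm_inv_Gamma_le hm k
  rw [div_eq_mul_inv, mul_inv, norm_mul, norm_mul, norm_inv (k.factorial : ℂ), div_eq_mul_inv,
    mul_comm _ (k.factorial : ℝ)⁻¹]
  simp only [norm_pow, norm_neg, norm_one, one_pow, one_mul, Complex.norm_natCast]
  gcongr

theorem norm_besselSeries_term_le {m : ℂ} (hm : -1 < m.re) (z : ℂ) (k : ℕ) :
    ‖(-1) ^ k / ((k.factorial : ℂ) * Gamma (m + k + 1)) * z ^ k‖ ≤
      (‖(Gamma (m + 1))⁻¹‖ + ‖(Gamma (m + 2))⁻¹‖) * (‖z‖ ^ k / k.factorial) := by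
  rw [norm_mul, norm_pow]
  calc _ ≤ _ := mul_le_mul_of_nonneg_right (norm_besselSeries_coeff_le hm k) (by positivity)
    _ = _ := by ring

theorem summable_norm_besselSeries {m : ℂ} (hm : -1 < m.re) (z : ℂ) :
    Summable fun k : ℕ => ‖(-1) ^ k / ((k.factorial : ℂ) * Gamma (m + k + 1)) * z ^ k‖ :=
  Summable.of_nonneg_of_le (fun _ => norm_nonneg _) (norm_besselSeries_term_le hm z)
    ((Real.summable_pow_div_factorial ‖z‖).mul_left _)

theorem summable_besselSeries {m : ℂ} (hm : -1 < m.re) (z : ℂ) :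
    Summable fun k : ℕ => (-1) ^ k / ((k.factorial : ℂ) * Gamma (m + k + 1)) * z ^ k :=
  (summable_norm_besselSeries hm z).of_norm

theorem hasDerivAt_besselSeries {m : ℂ} (hm : -1 < m.re) (z : ℂ) :
    HasDerivAt (besselSeries m) (-besselSeries (m + 1) z) z := by
  set A := ‖(Gamma (m + 1))⁻¹‖ + ‖(Gamma (m + 2))⁻¹‖
  set R := ‖z‖ + 1
  -- The terms of the differentiated series on the ball of radius `R`; shifted by one they form an
  -- exponential series.
  have hu : Summable fun k : ℕ => A / k.factorial * (k * R ^ (k - 1)) := by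
    rw [← summable_nat_add_iff 1]
    refine ((Real.summable_pow_div_factorial R).mul_left A).congr fun k => ?_
    rw [Nat.factorial_succ]
    have : (k.factorial : ℝ) ≠ 0 := by positivity
    have : (k : ℝ) + 1 ≠ 0 := by positivity
    push_cast
    field_simp
  have key := hasDerivAt_tsum_of_isPreconnected (𝕜 := ℂ) (F := ℂ) hu
    (g := fun (k : ℕ) z => (-1) ^ k / ((k.factorial : ℂ) * Gamma (m + k + 1)) * z ^ k)
    (g' := fun (k : ℕ) z => (-1) ^ k / ((k.factorial : ℂ) * Gamma (m + k + 1)) * (k * z ^ (k - 1)))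
    (t := Metric.ball 0 R) (y₀ := 0) (y := z) Metric.isOpen_ball
    (convex_ball (0 : ℂ) R).isPreconnected
    (fun k y _ => (hasDerivAt_pow k y).const_mul _)
    (fun k y hy => by
      rw [norm_mul, norm_mul, norm_pow, Complex.norm_natCast]
      have : ‖y‖ ≤ R := by simpa using (mem_ball_zero_iff.1 hy).le
      have := norm_besselSeries_coeff_le hm k
      gcongr)
    (by simp [R]; positivity) (summable_besselSeries hm 0) (by simp [R])
  convert! key using 1
  have hs : Summable fun k : ℕ =>
      (-1) ^ k / ((k.factorial : ℂ) * Gamma (m + k + 1)) * (k * z ^ (k - 1)) := by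
    refine Summable.of_norm_bounded hu fun k => ?_
    rw [norm_mul, norm_mul, norm_pow, Complex.norm_natCast]
    have : ‖z‖ ≤ R := by simp [R]
    have := norm_besselSeries_coeff_le hm k
    gcongr
  rw [hs.tsum_eq_zero_add, besselSeries, ← tsum_neg]
  simp only [Nat.cast_zero, zero_mul, mul_zero, zero_add]
  refine tsum_congr fun k => ?_
  have h1 : (k.factorial : ℂ) ≠ 0 := by exact_mod_cast k.factorial_ne_zero
  have h2 : (k : ℂ) + 1 ≠ 0 := by exact_mod_cast k.succ_ne_zero
  have h3 : m + 1 + (k : ℂ) + 1 = m + ((k : ℂ) + 1) + 1 := by ring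
  rw [Nat.factorial_succ, Nat.add_sub_cancel]
  push_cast
  rw [h3, pow_succ]
  field_simp

theorem continuous_besselSeries {m : ℂ} (hm : -1 < m.re) : Continuous (besselSeries m) :=
  continuous_iff_continuousAt.2 fun z => (hasDerivAt_besselSeries hm z).continuousAt

/-- Write `1/Γ(m+k+1) = (m+1+k)/Γ(m+k+2)`. The summand `m+1` gives the first series; the factor `k`
cancels against `k!` and an index shift gives the second. -/
theorem besselSeries_recurrence {m : ℂ} (hm : -1 < m.re) (z : ℂ) :
    besselSeries m z = (m + 1) * besselSeries (m + 1) z - z * besselSeries (m + 2) z := by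
  have hm1 : -1 < (m + 1).re := by simp; linarith
  have hm2 : -1 < (m + 2).re := by simp; linarith
  have h1 := (summable_besselSeries hm1 z).mul_left (m + 1)
  have h2 := (summable_besselSeries hm2 z).mul_left z
  have h0 := summable_besselSeries hm z
  rw [besselSeries, besselSeries, besselSeries, ← tsum_mul_left, ← tsum_mul_left,
    h0.tsum_eq_zero_add, h1.tsum_eq_zero_add, add_sub_assoc]
  rw [← Summable.tsum_sub ((summable_nat_add_iff 1).2 h1) h2]
  congr 1
  · have := one_div_Gamma_eq_self_mul_one_div_Gamma_add_one (m + 1)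
    simp [this]
  · refine tsum_congr fun k => ?_
    have h1 : (k.factorial : ℂ) ≠ 0 := by exact_mod_cast k.factorial_ne_zero
    have h2 : (k : ℂ) + 1 ≠ 0 := by exact_mod_cast k.succ_ne_zero
    have h3 := one_div_Gamma_eq_self_mul_one_div_Gamma_add_one (m + (k + 1) + 1)
    have h4 : m + 2 + (k : ℂ) + 1 = m + (k + 1) + 1 + 1 := by ring
    have h5 : m + 1 + ((k : ℂ) + 1) + 1 = m + (k + 1) + 1 + 1 := by ring
    rw [Nat.factorial_succ]
    push_cast
    rw [h4, h5]
    simp only [div_eq_mul_inv, mul_inv, h3, pow_succ]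
    field_simp
    ring

theorem hasDerivAt_half_sq (z : ℂ) : HasDerivAt (fun z : ℂ => (z / 2) ^ 2) (z / 2) z := by
  have := ((hasDerivAt_id z).div_const 2).pow 2
  convert! this using 1
  simp
  ring

theorem hasDerivAt_besselJ {m : ℂ} (hm : -1 < m.re) {x : ℝ} (hx : 0 < x) :
    HasDerivAt (fun x : ℝ => besselJ m x) (m / x * besselJ m x - besselJ (m + 1) x) x := by
  have hx0 : (x : ℂ) ≠ 0 := by exact_mod_cast hx.ne'
  have hx2 : (x : ℂ) / 2 ≠ 0 := div_ne_zero hx0 two_ne_zero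
  have h1 : HasDerivAt (fun z : ℂ => (z / 2) ^ m) (m * ((x : ℂ) / 2) ^ (m - 1) * (1 / 2)) x := by
    refine ((hasDerivAt_id (x : ℂ)).div_const 2).cpow_const ?_
    left
    simpa using hx
  have h2 := (hasDerivAt_besselSeries hm ((x / 2 : ℂ) ^ 2)).comp (x : ℂ) (hasDerivAt_half_sq x)
  have h3 := (h1.mul h2).comp_ofReal
  simp only [besselJ_eq]
  convert! h3 using 1
  rw [cpow_sub _ _ hx2, cpow_add _ _ hx2, cpow_one]
  simp only [Function.comp]
  field_simp
  ring

theorem besselJ_recurrence {m : ℂ} (hm : -1 < m.re) {x : ℝ} (hx : 0 < x) :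
    besselJ m x = 2 * (m + 1) / x * besselJ (m + 1) x - besselJ (m + 2) x := by
  have hx0 : (x : ℂ) ≠ 0 := by exact_mod_cast hx.ne'
  have hx2 : (x : ℂ) / 2 ≠ 0 := div_ne_zero hx0 two_ne_zero
  have h2 : (m + 2) = m + 1 + 1 := by ring
  rw [besselJ_eq, besselJ_eq, besselJ_eq, besselSeries_recurrence hm, h2]
  simp only [cpow_add _ _ hx2, cpow_one]
  field_simp

/-- Expressing the derivative through `J_m`, not `J_{m+2}`, is what allows integration by parts that
raises the order and so stays in the range `Re m > -1`. -/
theorem hasDerivAt_besselJ_add_one {m : ℂ} (hm : -1 < m.re) {x : ℝ} (hx : 0 < x) :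
    HasDerivAt (fun x : ℝ => besselJ (m + 1) x)
      (besselJ m x - (m + 1) / x * besselJ (m + 1) x) x := by
  have h := hasDerivAt_besselJ (m := m + 1) (by simp; linarith) hx
  convert! h using 1
  have h2 : m + 1 + 1 = m + 2 := by ring
  rw [besselJ_recurrence hm hx, h2]
  ring

theorem continuousOn_besselJ {m : ℂ} (hm : -1 < m.re) :
    ContinuousOn (fun x : ℝ => besselJ m x) (Ioi 0) := fun _ hx =>
  (hasDerivAt_besselJ hm hx).continuousAt.continuousWithinAt

/-! ### The bound `|J_n| ≤ 1` for integer order. -/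

theorem integral_exp_int_mul_I (p : ℤ) :
    ∫ θ in (0 : ℝ)..2 * Real.pi, exp (p * θ * I) = if p = 0 then 2 * (Real.pi : ℂ) else 0 := by
  split_ifs with hp
  · simp [hp]
  · have hc : (p : ℂ) * I ≠ 0 := mul_ne_zero (by exact_mod_cast hp) I_ne_zero
    have h := integral_exp_mul_complex (a := 0) (b := 2 * Real.pi) hc
    have h1 : ∀ θ : ℝ, (p : ℂ) * θ * I = p * I * θ := fun θ => by ring
    simp only [h1, h]
    have h2 : (p : ℂ) * I * ((2 * Real.pi : ℝ) : ℂ) = p * (2 * Real.pi * I) := by push_cast; ring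
    rw [h2, exp_int_mul_two_pi_mul_I]
    simp

theorem hasSum_integral_exp_int {ι : Type*} [Countable ι] {a : ι → ℂ} (ha : Summable fun i => ‖a i‖)
    (p : ι → ℤ) :
    HasSum (fun i => a i * if p i = 0 then 2 * (Real.pi : ℂ) else 0)
      (∫ θ in (0 : ℝ)..2 * Real.pi, ∑' i, a i * exp (p i * θ * I)) := by
  have hn : ∀ i (θ : ℝ), ‖a i * exp (p i * θ * I)‖ = ‖a i‖ := fun i θ => by
    rw [norm_mul, show (p i : ℂ) * θ * I = ((p i * θ : ℝ) : ℂ) * I by push_cast; ring,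
      norm_exp_ofReal_mul_I, mul_one]
  have := intervalIntegral.hasSum_integral_of_dominated_convergence
    (μ := volume) (a := 0) (b := 2 * Real.pi)
    (F := fun i (θ : ℝ) => a i * exp (p i * θ * I))
    (f := fun θ : ℝ => ∑' i, a i * exp (p i * θ * I)) (fun i _ => ‖a i‖)
    (fun i => (by fun_prop : Continuous _).aestronglyMeasurable)
    (fun i => .of_forall fun θ _ => (hn i θ).le)
    (.of_forall fun θ _ => ha) (by simp)
    (.of_forall fun θ _ => (Summable.of_norm (by simpa only [hn] using ha)).hasSum)
  simpa only [intervalIntegral.integral_const_mul, integral_exp_int_mul_I] using this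

/-- `J_n(x)` is the `n`-th Fourier coefficient of `exp((x/2)(e^{iθ} - e^{-iθ}))`, a function of
modulus one since the exponent is purely imaginary. -/
theorem norm_besselJ_nat_le_one (n : ℕ) (x : ℝ) : ‖besselJ n x‖ ≤ 1 := by
  set r : ℂ := x / 2 with hr
  let c : ℂ → ℕ → ℂ := fun z j => z ^ j / j.factorial
  have hc : ∀ z : ℂ, Summable fun j => ‖c z j‖ := fun z => by
    simpa [c] using Real.summable_pow_div_factorial ‖z‖
  have hexp : ∀ z : ℂ, exp z = ∑' j, c z j := fun z => by
    rw [exp_eq_exp_ℂ, NormedSpace.exp_eq_tsum_div]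
  have ha := Summable.mul_norm (hc r) (hc (-r))
  have hsum := hasSum_integral_exp_int (a := fun i : ℕ × ℕ => c r i.1 * c (-r) i.2)
    ha (fun i => (i.1 : ℤ) - i.2 - n)
  have hf : ∀ θ : ℝ, ∑' i : ℕ × ℕ, c r i.1 * c (-r) i.2 *
      exp ((((i.1 : ℤ) - i.2 - n : ℤ) : ℂ) * θ * I) =
      exp (r * exp (θ * I)) * exp (-r * exp (-(θ * I))) * exp (-(n * θ * I)) := fun θ => by
    rw [hexp (r * _), hexp (-r * _), tsum_mul_tsum_of_summable_norm (hc _) (hc _), ← tsum_mul_right]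
    refine tsum_congr fun i => ?_
    simp only [c, mul_pow, ← exp_nat_mul]
    have : exp ((((i.1 : ℤ) - i.2 - n : ℤ) : ℂ) * θ * I) =
        exp (i.1 * (θ * I)) * exp (i.2 * -(θ * I)) * exp (-(n * θ * I)) := by
      rw [← exp_add, ← exp_add]
      congr 1
      push_cast
      ring
    rw [this]
    ring
  have hJ : besselJ n x * (2 * Real.pi) = ∫ θ in (0 : ℝ)..2 * Real.pi,
      exp (r * exp (θ * I)) * exp (-r * exp (-(θ * I))) * exp (-(n * θ * I)) := by
    simp only [← hf]
    rw [← hsum.tsum_eq]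
    -- Only the pairs `(k+n, k)` have frequency zero; they enumerate the series of `J_n`.
    have hinj : Function.Injective fun k : ℕ => (k + n, k) := fun i j h => (Prod.ext_iff.1 h).2
    rw [← hinj.tsum_eq]
    · rw [besselJ, ← tsum_mul_left, ← tsum_mul_right]
      refine tsum_congr fun k => ?_
      have h1 : ((n : ℂ) + k + 1) = ((k + n : ℕ) : ℂ) + 1 := by push_cast; ring
      have h2 : ((k + n : ℕ) : ℤ) - (k : ℤ) - n = 0 := by push_cast; ring
      rw [h1, Gamma_nat_eq_factorial, cpow_natCast]
      simp only [h2, c, ← hr, if_true]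
      rw [neg_pow r k]
      field_simp
      ring
    · intro i hi
      have h : (i.1 : ℤ) - i.2 - n = 0 := by
        by_contra h
        simp [h] at hi
      refine ⟨i.2, Prod.ext ?_ rfl⟩
      simp only
      omega
  have hbd : ‖besselJ n x * (2 * Real.pi)‖ ≤ 1 * |2 * Real.pi - 0| := by
    rw [hJ]
    refine intervalIntegral.norm_integral_le_of_norm_le_const fun θ _ => ?_
    rw [norm_mul, norm_mul, norm_exp, norm_exp, norm_exp]
    have h1 : (r * exp (θ * I)).re = x / 2 * Real.cos θ := by
      rw [hr, show (x : ℂ) / 2 = ((x / 2 : ℝ) : ℂ) by push_cast; rfl, re_ofReal_mul,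
        exp_ofReal_mul_I_re]
    have h2 : (-r * exp (-(θ * I))).re = -(x / 2 * Real.cos θ) := by
      rw [hr, show -((x : ℂ) / 2) = ((-(x / 2) : ℝ) : ℂ) by push_cast; rfl, re_ofReal_mul,
        show -((θ : ℂ) * I) = ((-θ : ℝ) : ℂ) * I by push_cast; ring, exp_ofReal_mul_I_re,
        Real.cos_neg]
      ring
    have h3 : (-((n : ℂ) * θ * I)).re = 0 := by simp
    rw [h1, h2, h3, ← Real.exp_add]
    simp
  have hpi := Real.pi_pos
  rw [norm_mul, sub_zero, abs_of_pos (by positivity)] at hbd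
  have : ‖(2 * Real.pi : ℂ)‖ = 2 * Real.pi := by simp [abs_of_pos hpi]
  rw [this] at hbd
  exact le_of_mul_le_mul_right hbd (by positivity)

/-! ### Neumann's formula and the passage from order `2ν` to order `ν`. -/

theorem descPochhammer_smeval_add_natCast {w : ℂ} (hw : -1 < w.re) (j : ℕ) :
    (descPochhammer ℤ j).smeval (w + j) = Gamma (w + j + 1) / Gamma (w + 1) := by
  have h : ∀ k : ℕ, w + 1 ≠ -k := fun k h => by
    have h1 := congrArg re h
    simp at h1
    have h2 : (0 : ℝ) ≤ k := k.cast_nonneg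
    linarith
  have h2 : w + j - j + 1 = w + 1 := by ring
  have h3 : w + j + 1 = w + 1 + j := by ring
  rw [Polynomial.descPochhammer_smeval_eq_ascPochhammer, h2, h3, Gamma_add_nat_div_Gamma_eq _ h,
    Polynomial.ascPochhammer_smeval_eq_eval]

/-- This is the Chu–Vandermonde identity for the falling factorial of `(s+k) + (s+k)`, divided by
`k! Γ(s+k+1)^2`. -/
theorem sum_antidiagonal_inv_Gamma {s : ℂ} (hs : -1 / 2 < s.re) (k : ℕ) :
    ∑ ij ∈ Finset.HasAntidiagonal.antidiagonal k, ((ij.1.factorial : ℂ) * Gamma (s + ij.1 + 1))⁻¹ *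
      ((ij.2.factorial : ℂ) * Gamma (s + ij.2 + 1))⁻¹ =
    Gamma (2 * s + 2 * k + 1) / (k.factorial * Gamma (s + k + 1) ^ 2 * Gamma (2 * s + k + 1)) := by
  have hG : ∀ w : ℂ, -1 < w.re → Gamma (w + 1) ≠ 0 := fun w hw =>
    Gamma_ne_zero_of_re_pos (by simp; linarith)
  have hk0 : (0 : ℝ) ≤ k := k.cast_nonneg
  have hk : (k.factorial : ℂ) ≠ 0 := by exact_mod_cast k.factorial_ne_zero
  have hGk : Gamma (s + k + 1) ≠ 0 := hG _ (by simp; linarith)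
  have hG2 : Gamma (2 * s + k + 1) ≠ 0 := hG _ (by simp; linarith)
  have hd : (descPochhammer ℤ k).smeval ((s + k) + (s + k)) =
      Gamma (2 * s + 2 * k + 1) / Gamma (2 * s + k + 1) := by
    have h := descPochhammer_smeval_add_natCast (w := 2 * s + k) (by simp; linarith) k
    have h1 : 2 * s + k + k = (s + k) + (s + k) := by ring
    rw [← h1, h]
    congr 2
    ring
  have hv := Ring.descPochhammer_smeval_add k (Commute.all (s + k) (s + k))
  rw [hd] at hv
  have hterm : ∀ ij ∈ Finset.HasAntidiagonal.antidiagonal k, (Nat.choose k ij.1 : ℂ) *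
      ((descPochhammer ℤ ij.1).smeval (s + (k : ℂ)) *
        (descPochhammer ℤ ij.2).smeval (s + (k : ℂ))) =
      k.factorial * Gamma (s + k + 1) ^ 2 * (((ij.1.factorial : ℂ) * Gamma (s + ij.1 + 1))⁻¹ *
      ((ij.2.factorial : ℂ) * Gamma (s + ij.2 + 1))⁻¹) := by
    rintro ⟨i, j⟩ hij
    have hij' : i + j = k := Finset.HasAntidiagonal.mem_antidiagonal.1 hij
    have hi0 : (0 : ℝ) ≤ i := i.cast_nonneg
    have hj0 : (0 : ℝ) ≤ j := j.cast_nonneg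
    have h1 := descPochhammer_smeval_add_natCast (w := s + j) (by simp; linarith) i
    have h2 := descPochhammer_smeval_add_natCast (w := s + i) (by simp; linarith) j
    have e1 : s + j + i = s + k := by rw [← hij']; push_cast; ring
    have e2 : s + i + j = s + k := by rw [← hij']; push_cast; ring
    rw [e1] at h1
    rw [e2] at h2
    have hc : (Nat.choose k i : ℂ) * i.factorial * j.factorial = k.factorial := by
      have := Nat.choose_mul_factorial_mul_factorial (hij' ▸ Nat.le_add_right i j : i ≤ k)
      rw [← hij', Nat.add_sub_cancel_left, hij'] at this
      exact_mod_cast this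
    have hi : (i.factorial : ℂ) ≠ 0 := by exact_mod_cast i.factorial_ne_zero
    have hj : (j.factorial : ℂ) ≠ 0 := by exact_mod_cast j.factorial_ne_zero
    have hGi : Gamma (s + i + 1) ≠ 0 := hG _ (by simp; linarith)
    have hGj : Gamma (s + j + 1) ≠ 0 := hG _ (by simp; linarith)
    simp only [h1, h2, ← hc]
    field_simp
  rw [Finset.sum_congr rfl hterm, ← Finset.mul_sum] at hv
  rw [div_eq_iff hG2] at hv
  rw [hv, eq_div_iff (mul_ne_zero (mul_ne_zero hk (pow_ne_zero 2 hGk)) hG2)]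
  ring

theorem besselSeries_sq {s : ℂ} (hs : -1 / 2 < s.re) (z : ℂ) :
    besselSeries s z ^ 2 = ∑' k : ℕ, (-1) ^ k * z ^ k *
      (Gamma (2 * s + 2 * k + 1) /
        (k.factorial * Gamma (s + k + 1) ^ 2 * Gamma (2 * s + k + 1))) := by
  have hs1 : -1 < s.re := by linarith
  rw [sq, besselSeries, tsum_mul_tsum_eq_tsum_sum_antidiagonal_of_summable_norm
    (summable_norm_besselSeries hs1 z) (summable_norm_besselSeries hs1 z)]
  refine tsum_congr fun k => ?_
  rw [← sum_antidiagonal_inv_Gamma hs, Finset.mul_sum]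
  refine Finset.sum_congr rfl ?_
  rintro ⟨i, j⟩ hij
  rw [← Finset.HasAntidiagonal.mem_antidiagonal.1 hij, pow_add, pow_add]
  simp only [div_eq_mul_inv]
  ring

/-- Legendre duplication removes `Γ(s+k+1/2)` from the Beta function, leaving exactly the Gamma
quotient in the coefficients of `besselSeries_sq`. -/
theorem betaIntegral_add_nat_half {s : ℂ} (hs : -1 / 2 < s.re) (k : ℕ) :
    betaIntegral (s + k + 1 / 2) (1 / 2) =
      Real.pi * 2 ^ (-(2 * s)) * (4 ^ k)⁻¹ * Gamma (2 * s + 2 * k + 1) / Gamma (s + k + 1) ^ 2 := by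
  have hk0 : (0 : ℝ) ≤ k := k.cast_nonneg
  have hG : Gamma (s + k + 1) ≠ 0 := Gamma_ne_zero_of_re_pos (by simp; linarith)
  have h1 := Gamma_mul_Gamma_eq_betaIntegral (s := s + k + 1 / 2) (t := 1 / 2)
    (by simp; linarith) (by simp)
  have h2 := Gamma_mul_Gamma_add_half (s + k + 1 / 2)
  have e1 : s + k + 1 / 2 + 1 / 2 = s + k + 1 := by ring
  have e2 : 2 * (s + k + 1 / 2) = 2 * s + 2 * k + 1 := by ring
  have e3 : 1 - (2 * s + 2 * k + 1) = -(2 * s) - ((2 * k : ℕ) : ℂ) := by push_cast; ring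
  have e4 : (2 : ℂ) ^ (2 * k) = 4 ^ k := by rw [pow_mul]; norm_num
  have e5 : Gamma (1 / 2) * (√Real.pi : ℂ) = Real.pi := by
    have h := Real.Gamma_one_half_eq
    have h' : Gamma (1 / 2) = (√Real.pi : ℂ) := by
      rw [← h, ← Gamma_ofReal]
      norm_num
    rw [h', ← ofReal_mul, Real.mul_self_sqrt Real.pi_pos.le]
  rw [e1] at h1 h2
  rw [e2, e3, cpow_sub _ _ two_ne_zero, cpow_natCast, e4] at h2
  rw [eq_div_iff (pow_ne_zero 2 hG)]
  have h4 : (4 : ℂ) ^ k ≠ 0 := pow_ne_zero _ (by norm_num)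
  calc _ = (Gamma (s + k + 1) * betaIntegral (s + k + 1 / 2) (1 / 2)) * Gamma (s + k + 1) := by ring
    _ = Gamma (1 / 2) * (Gamma (s + k + 1 / 2) * Gamma (s + k + 1)) := by rw [← h1]; ring
    _ = (Gamma (1 / 2) * (√Real.pi : ℂ)) * 2 ^ (-(2 * s)) * (4 ^ k)⁻¹ *
        Gamma (2 * s + 2 * k + 1) := by rw [h2]; ring
    _ = _ := by rw [e5]

/-- Termwise integration of the series of order `2s` produces Beta integrals, which match the Cauchy
square. With `z = (x/2)^2` and `t = cos² θ` this is Neumann's integral for `J_s(x)^2`. -/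
theorem besselSeries_sq_eq_integral {s : ℂ} (hs : -1 / 2 < s.re) (z : ℂ) :
    besselSeries s z ^ 2 * (Real.pi * 2 ^ (-(2 * s))) =
      ∫ t in (0 : ℝ)..1, (t : ℂ) ^ (s + 1 / 2 - 1) * (1 - (t : ℂ)) ^ ((1 / 2 : ℂ) - 1) *
        besselSeries (2 * s) (4 * z * t) := by
  have hs2 : -1 < (2 * s).re := by simp; linarith
  set A := ‖(Gamma (2 * s + 1))⁻¹‖ + ‖(Gamma (2 * s + 2))⁻¹‖
  set w : ℝ → ℂ := fun t => (t : ℂ) ^ (s + 1 / 2 - 1) * (1 - (t : ℂ)) ^ ((1 / 2 : ℂ) - 1) with hw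
  have hwi : IntervalIntegrable w volume 0 1 :=
    betaIntegral_convergent (by simp; linarith) (by simp)
  let g : ℕ → ℝ → ℂ := fun k t =>
    (-1) ^ k / ((k.factorial : ℂ) * Gamma (2 * s + k + 1)) * (4 * z * t) ^ k
  have hsum := intervalIntegral.hasSum_integral_of_dominated_convergence
    (μ := volume) (a := 0) (b := 1) (F := fun k t => w t * g k t)
    (f := fun t => w t * besselSeries (2 * s) (4 * z * t))
    (fun k t => ‖w t‖ * (A * (‖4 * z‖ ^ k / k.factorial)))
    (fun k => by
      rw [uIoc_of_le zero_le_one]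
      exact hwi.aestronglyMeasurable.mul
        (by fun_prop : Continuous (g k)).aestronglyMeasurable)
    (fun k => .of_forall fun t ht => by
      rw [uIoc_of_le zero_le_one] at ht
      rw [norm_mul]
      have h1 : ‖4 * z * t‖ ≤ ‖4 * z‖ := by
        rw [norm_mul, norm_real, Real.norm_of_nonneg ht.1.le]
        exact mul_le_of_le_one_right (norm_nonneg _) ht.2
      refine mul_le_mul_of_nonneg_left ((norm_besselSeries_term_le hs2 _ k).trans ?_)
        (norm_nonneg _)
      gcongr)
    (.of_forall fun t _ =>
      ((Real.summable_pow_div_factorial _).mul_left A).mul_left _)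
    (by
      simp only [tsum_mul_left]
      exact hwi.norm.mul_const _)
    (.of_forall fun t _ => (summable_besselSeries hs2 _).hasSum.mul_left _)
  rw [← hsum.tsum_eq, besselSeries_sq hs, ← tsum_mul_right]
  refine tsum_congr fun k => ?_
  have hint : ∫ t in (0 : ℝ)..1, w t * g k t =
      (-1) ^ k / ((k.factorial : ℂ) * Gamma (2 * s + k + 1)) * (4 * z) ^ k *
        betaIntegral (s + k + 1 / 2) (1 / 2) := by
    rw [betaIntegral, ← intervalIntegral.integral_const_mul]
    refine intervalIntegral.integral_congr_ae (.of_forall fun t ht => ?_)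
    rw [uIoc_of_le zero_le_one] at ht
    have ht0 : (t : ℂ) ≠ 0 := by exact_mod_cast ht.1.ne'
    have e : s + k + 1 / 2 - 1 = (s + 1 / 2 - 1) + k := by ring
    rw [e, cpow_add _ _ ht0, cpow_natCast]
    simp only [hw, g, mul_pow]
    ring
  rw [hint, betaIntegral_add_nat_half hs, mul_pow]
  have h4 : (4 : ℂ) ^ k ≠ 0 := pow_ne_zero _ (by norm_num)
  field_simp

theorem integral_arcsine_weight :
    ∫ t in (0 : ℝ)..1, t ^ (-1 / 2 : ℝ) * (1 - t) ^ (-1 / 2 : ℝ) = Real.pi := by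
  have h := betaIntegral_add_nat_half (s := 0) (by norm_num) 0
  simp only [Nat.cast_zero, mul_zero, add_zero, zero_add, neg_zero, cpow_zero, pow_zero, Gamma_one,
    inv_one, mul_one, one_pow, div_one] at h
  rw [betaIntegral] at h
  have h2 : ∫ t in (0 : ℝ)..1, (t : ℂ) ^ ((1 / 2 : ℂ) - 1) * (1 - (t : ℂ)) ^ ((1 / 2 : ℂ) - 1) =
      ∫ t in (0 : ℝ)..1, ((t ^ (-1 / 2 : ℝ) * (1 - t) ^ (-1 / 2 : ℝ) : ℝ) : ℂ) := by
    refine intervalIntegral.integral_congr_ae (.of_forall fun t ht => ?_)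
    rw [uIoc_of_le zero_le_one] at ht
    rw [ofReal_mul, ofReal_cpow ht.1.le, ofReal_cpow (by linarith [ht.2])]
    push_cast
    norm_num
  rw [h2, intervalIntegral.integral_ofReal] at h
  exact_mod_cast h

/-- A non-integrable function has integral `0` by convention, so the value `π` already proves
integrability. -/
theorem intervalIntegrable_arcsine_weight : IntervalIntegrable
    (fun t : ℝ => t ^ (-1 / 2 : ℝ) * (1 - t) ^ (-1 / 2 : ℝ)) volume 0 1 :=
  intervalIntegral.intervalIntegrable_of_integral_ne_zero
    (by rw [integral_arcsine_weight]; exact Real.pi_ne_zero)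

theorem norm_besselJ_le_one_of_double {ν : ℝ} (hν : 0 ≤ ν)
    (h : ∀ x : ℝ, 0 < x → ‖besselJ ((2 * ν : ℝ) : ℂ) x‖ ≤ 1) {x : ℝ} (hx : 0 < x) :
    ‖besselJ ν x‖ ≤ 1 := by
  have hpi := Real.pi_pos
  have key := besselSeries_sq_eq_integral (s := ν) (by simp; linarith) ((x / 2 : ℂ) ^ 2)
  have hbd : ∀ t ∈ Ioo (0 : ℝ) 1, ‖(t : ℂ) ^ ((ν : ℂ) + 1 / 2 - 1) *
      (1 - (t : ℂ)) ^ ((1 / 2 : ℂ) - 1) * besselSeries (2 * ν) (4 * (x / 2 : ℂ) ^ 2 * t)‖ ≤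
      x ^ (-(2 * ν)) * (t ^ (-1 / 2 : ℝ) * (1 - t) ^ (-1 / 2 : ℝ)) := fun t ht => by
    -- The assumed bound is used at `2x√t`, whose half squared is the argument `4(x/2)^2 t` of the
    -- series.
    have hs := Real.sqrt_pos.2 ht.1
    have h1 := h (2 * x * √t) (by positivity)
    have e1 : (((2 * x * √t : ℝ) : ℂ) / 2) = ((x * √t : ℝ) : ℂ) := by push_cast; ring
    have e2 : ((x * √t : ℝ) : ℂ) ^ 2 = 4 * (x / 2 : ℂ) ^ 2 * t := by
      rw [← ofReal_pow, mul_pow, Real.sq_sqrt ht.1.le]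
      push_cast
      ring
    have e3 : (((2 * ν : ℝ)) : ℂ) = 2 * ν := by push_cast; rfl
    have e4 : (x * √t) ^ (2 * ν) = x ^ (2 * ν) * t ^ ν := by
      rw [Real.mul_rpow hx.le hs.le, Real.sqrt_eq_rpow, ← Real.rpow_mul ht.1.le]
      congr 2
      ring
    rw [besselJ_eq, e1, e2, norm_mul, norm_cpow_eq_rpow_re_of_pos (by positivity), ofReal_re, e4,
      e3] at h1
    have e5 : (1 : ℂ) - t = ((1 - t : ℝ) : ℂ) := by push_cast; rfl
    rw [norm_mul, norm_mul, e5, norm_cpow_eq_rpow_re_of_pos ht.1,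
      norm_cpow_eq_rpow_re_of_pos (by linarith [ht.2])]
    have e6 : ((ν : ℂ) + 1 / 2 - 1).re = ν + -1 / 2 := by simp; ring
    have e7 : ((1 / 2 : ℂ) - 1).re = -1 / 2 := by simp; norm_num
    rw [e6, e7, Real.rpow_add ht.1, Real.rpow_neg hx.le]
    have hX : 0 < x ^ (2 * ν) := Real.rpow_pos_of_pos hx _
    have hT : 0 < t ^ (-1 / 2 : ℝ) := Real.rpow_pos_of_pos ht.1 _
    have hT' : 0 < (1 - t) ^ (-1 / 2 : ℝ) := Real.rpow_pos_of_pos (by linarith [ht.2]) _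
    set B := ‖besselSeries (2 * ν) (4 * (x / 2 : ℂ) ^ 2 * t)‖
    calc t ^ ν * t ^ (-1 / 2 : ℝ) * (1 - t) ^ (-1 / 2 : ℝ) * B
        = (x ^ (2 * ν))⁻¹ * (t ^ (-1 / 2 : ℝ) * (1 - t) ^ (-1 / 2 : ℝ)) *
          (x ^ (2 * ν) * t ^ ν * B) := by field_simp
      _ ≤ (x ^ (2 * ν))⁻¹ * (t ^ (-1 / 2 : ℝ) * (1 - t) ^ (-1 / 2 : ℝ)) * 1 := by gcongr
      _ = _ := mul_one _
  have hn := intervalIntegral.norm_integral_le_of_norm_le zero_le_one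
    (g := fun t => x ^ (-(2 * ν)) * (t ^ (-1 / 2 : ℝ) * (1 - t) ^ (-1 / 2 : ℝ)))
    (f := fun t : ℝ => (t : ℂ) ^ ((ν : ℂ) + 1 / 2 - 1) *
      (1 - (t : ℂ)) ^ ((1 / 2 : ℂ) - 1) * besselSeries (2 * ν) (4 * (x / 2 : ℂ) ^ 2 * t))
    (μ := volume) (by
      filter_upwards [compl_mem_ae_iff.2 (measure_singleton (1 : ℝ))] with t ht1 ht
      exact hbd t ⟨ht.1, lt_of_le_of_ne ht.2 ht1⟩)
    (intervalIntegrable_arcsine_weight.const_mul _)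
  rw [← key, intervalIntegral.integral_const_mul, integral_arcsine_weight, norm_mul, norm_mul,
    norm_pow, norm_real, Real.norm_of_nonneg hpi.le] at hn
  have e8 : ‖(2 : ℂ) ^ (-(2 * (ν : ℂ)))‖ = 2 ^ (-(2 * ν)) := by
    have := norm_cpow_eq_rpow_re_of_pos (x := 2) two_pos (-(2 * (ν : ℂ)))
    simpa using this
  rw [e8] at hn
  set B := ‖besselSeries ν ((x / 2 : ℂ) ^ 2)‖
  have e9 : ‖besselJ ν x‖ = (x / 2) ^ ν * B := by
    rw [besselJ_eq, norm_mul, show (x : ℂ) / 2 = ((x / 2 : ℝ) : ℂ) by push_cast; rfl,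
      norm_cpow_eq_rpow_re_of_pos (by positivity), ofReal_re]
    simp only [B, ofReal_div, ofReal_ofNat]
  have hn' : B ^ 2 * 2 ^ (-(2 * ν)) ≤ x ^ (-(2 * ν)) := by
    have : B ^ 2 * 2 ^ (-(2 * ν)) * Real.pi ≤ x ^ (-(2 * ν)) * Real.pi := by linarith
    exact le_of_mul_le_mul_right this hpi
  rw [Real.rpow_neg two_pos.le, Real.rpow_neg hx.le] at hn'
  have h2 : (0 : ℝ) < 2 ^ (2 * ν) := Real.rpow_pos_of_pos two_pos _
  have hX : 0 < x ^ (2 * ν) := Real.rpow_pos_of_pos hx _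
  have e10 : ((x / 2) ^ ν) ^ 2 = x ^ (2 * ν) / 2 ^ (2 * ν) := by
    rw [← Real.rpow_natCast, ← Real.rpow_mul (by positivity), Real.div_rpow hx.le two_pos.le]
    push_cast
    rw [mul_comm ν 2]
  rw [e9]
  refine (sq_le_one_iff₀ (by positivity)).1 ?_
  rw [mul_pow, e10]
  calc x ^ (2 * ν) / 2 ^ (2 * ν) * B ^ 2 = x ^ (2 * ν) * (B ^ 2 * (2 ^ (2 * ν))⁻¹) := by ring
    _ ≤ x ^ (2 * ν) * (x ^ (2 * ν))⁻¹ := by gcongr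
    _ = 1 := mul_inv_cancel₀ hX.ne'

/-! ### From dyadic to all nonnegative real orders. -/

/-- Since `1/Γ` is entire, each term is continuous in the order, and compactness of `[0,V]` makes
the domination uniform. -/
theorem continuousOn_besselJ_order {V : ℝ} {x : ℝ} (hx : 0 < x) :
    ContinuousOn (fun ν : ℝ => besselJ ν x) (Icc 0 V) := by
  have hx2 : (x : ℂ) / 2 ≠ 0 := div_ne_zero (by exact_mod_cast hx.ne') two_ne_zero
  have hG : ∀ a : ℂ, Continuous fun ν : ℝ => (Gamma (ν + a))⁻¹ := fun a =>
    differentiable_one_div_Gamma.continuous.comp (by fun_prop : Continuous fun ν : ℝ => (ν : ℂ) + a)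
  obtain ⟨A, hA⟩ := isCompact_Icc.exists_bound_of_continuousOn (s := Icc 0 V)
    ((hG 1).norm.add (hG 2).norm).continuousOn
  have hser : ContinuousOn (fun ν : ℝ => besselSeries ν ((x / 2 : ℂ) ^ 2)) (Icc 0 V) := by
    unfold besselSeries
    generalize ((x : ℂ) / 2) ^ 2 = z
    refine continuousOn_tsum (f := fun (k : ℕ) (ν : ℝ) =>
      (-1) ^ k / ((k.factorial : ℂ) * Gamma (ν + k + 1)) * z ^ k)
      (u := fun k => A * (‖z‖ ^ k / k.factorial)) (fun k => ?_)
      ((Real.summable_pow_div_factorial ‖z‖).mul_left A) (fun k ν hν => ?_)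
    · have h := hG (k + 1)
      simp only [div_eq_mul_inv, mul_inv, add_assoc]
      exact ((continuous_const.mul (continuous_const.mul h)).mul continuous_const).continuousOn
    · refine (norm_besselSeries_term_le (by simp; linarith [hν.1]) z k).trans ?_
      exact mul_le_mul_of_nonneg_right ((le_abs_self _).trans (hA ν hν)) (by positivity)
  have hpow : Continuous fun ν : ℝ => ((x : ℂ) / 2) ^ (ν : ℂ) :=
    continuous_ofReal.const_cpow (Or.inl hx2)
  simp only [besselJ_eq]
  exact hpow.continuousOn.mul hser

theorem norm_besselJ_dyadic_le_one (n k : ℕ) {x : ℝ} (hx : 0 < x) :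
    ‖besselJ ((n / 2 ^ k : ℝ) : ℂ) x‖ ≤ 1 := by
  induction k generalizing x with
  | zero => simpa using norm_besselJ_nat_le_one n x
  | succ k ih =>
    refine norm_besselJ_le_one_of_double (by positivity) (fun y hy => ?_) hx
    have : (2 * (n / 2 ^ (k + 1)) : ℝ) = n / 2 ^ k := by
      rw [pow_succ]
      field_simp
    rw [this]
    exact ih hy

theorem norm_besselJ_le_one {ν : ℝ} (hν : 0 ≤ ν) {x : ℝ} (hx : 0 < x) : ‖besselJ ν x‖ ≤ 1 := by
  have h2 : Tendsto (fun k : ℕ => (2 : ℝ) ^ k) atTop atTop :=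
    tendsto_pow_atTop_atTop_of_one_lt one_lt_two
  have ht : Tendsto (fun k : ℕ => (⌊ν * 2 ^ k⌋₊ / 2 ^ k : ℝ)) atTop (𝓝[Icc 0 ν] ν) := by
    have h3 : Tendsto (fun y : ℝ => (⌊ν * y⌋₊ / y : ℝ)) atTop (𝓝 ν) :=
      tendsto_nat_floor_mul_div_atTop hν
    refine tendsto_nhdsWithin_iff.2 ⟨h3.comp h2, .of_forall fun k => ⟨by positivity, ?_⟩⟩
    rw [div_le_iff₀ (by positivity)]
    exact Nat.floor_le (by positivity)
  have hc : Tendsto (fun ν : ℝ => ‖besselJ ν x‖) (𝓝[Icc 0 ν] ν) (𝓝 ‖besselJ ν x‖) :=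
    (continuousOn_besselJ_order hx ν ⟨hν, le_rfl⟩).norm
  have hb : ∀ k : ℕ, ‖besselJ ((⌊ν * 2 ^ k⌋₊ / 2 ^ k : ℝ) : ℂ) x‖ ≤ 1 := fun k =>
    norm_besselJ_dyadic_le_one _ k hx
  exact le_of_tendsto (hc.comp ht) (.of_forall hb)

/-! ### Boundedness of `J_m` on `[1,∞)` for complex order. -/

/-- Energy method for `y'' = -y - y'/x + (m²/x²) y`. In the derivative of `E = |y|² + |y'|²` the
cross terms cancel and the damping term is nonpositive, so `E' ≤ (|m|²/x²) E`, with an integrable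
rate. -/
theorem exists_norm_besselJ_le {m : ℂ} (hm : -1 < m.re) :
    ∃ C : ℝ, 0 ≤ C ∧ ∀ x : ℝ, 1 ≤ x → ‖besselJ m x‖ ≤ C := by
  set y : ℝ → ℂ := fun x => besselJ m x
  set y' : ℝ → ℂ := fun x => m / x * besselJ m x - besselJ (m + 1) x
  have hy : ∀ x : ℝ, 0 < x → HasDerivAt y (y' x) x := fun x hx => hasDerivAt_besselJ hm hx
  have hy' : ∀ x : ℝ, 0 < x →
      HasDerivAt y' (-y x - (x⁻¹ : ℝ) • y' x + m ^ 2 / x ^ 2 * y x) x := fun x hx => by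
    have hx0 : (x : ℂ) ≠ 0 := by exact_mod_cast hx.ne'
    have h1 : HasDerivAt (fun x : ℝ => m / (x : ℂ)) (-m / x ^ 2) x := by
      have := (((hasDerivAt_id (x : ℂ)).inv hx0).const_mul m).comp_ofReal
      convert! this using 1
      simp
      ring
    convert! (h1.mul (hy x hx)).sub (hasDerivAt_besselJ_add_one hm hx) using 1
    simp only [y, y', real_smul, ofReal_inv]
    field_simp
    ring
  set E : ℝ → ℝ := fun x => ‖y x‖ ^ 2 + ‖y' x‖ ^ 2 with hE
  set E' : ℝ → ℝ := fun x => 2 * inner ℝ (y x) (y' x) +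
    2 * inner ℝ (y' x) (-y x - (x⁻¹ : ℝ) • y' x + m ^ 2 / x ^ 2 * y x)
  have hEd : ∀ x : ℝ, 0 < x → HasDerivAt E (E' x) x := fun x hx =>
    (hy x hx).norm_sq.add (hy' x hx).norm_sq
  have hEb : ∀ x : ℝ, 0 < x → E' x ≤ ‖m‖ ^ 2 / x ^ 2 * E x := fun x hx => by
    have h1 : inner ℝ (y' x) (m ^ 2 / x ^ 2 * y x) ≤ ‖m‖ ^ 2 / x ^ 2 * (‖y' x‖ * ‖y x‖) := by
      refine (real_inner_le_norm _ _).trans_eq ?_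
      rw [norm_mul, norm_div, norm_pow, norm_pow, norm_real, Real.norm_of_nonneg hx.le]
      ring
    have h2 : 0 ≤ x⁻¹ * ‖y' x‖ ^ 2 := by positivity
    have h3 : ‖m‖ ^ 2 / x ^ 2 * (2 * (‖y' x‖ * ‖y x‖)) ≤ ‖m‖ ^ 2 / x ^ 2 * E x := by
      refine mul_le_mul_of_nonneg_left ?_ (by positivity)
      have := sq_nonneg (‖y x‖ - ‖y' x‖)
      simp only [hE]
      linarith
    simp only [E', inner_add_right, inner_sub_right, inner_neg_right, inner_smul_right,
      real_inner_self_eq_norm_sq, real_inner_comm (y x) (y' x)]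
    linarith
  -- The integrating factor: `|m|²/x` has derivative `-|m|²/x²`, so `W` decreases, and `E ≤ W`.
  set W : ℝ → ℝ := fun x => E x * Real.exp (‖m‖ ^ 2 / x)
  have hWd : ∀ x : ℝ, 0 < x → HasDerivAt W
      ((E' x - ‖m‖ ^ 2 / x ^ 2 * E x) * Real.exp (‖m‖ ^ 2 / x)) x := fun x hx => by
    have h1 := (((hasDerivAt_id x).inv hx.ne').const_mul (‖m‖ ^ 2)).exp
    convert! (hEd x hx).mul h1 using 1
    simp [div_eq_mul_inv]
    ring
  have hanti : AntitoneOn W (Ici 1) := by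
    refine antitoneOn_of_deriv_nonpos (convex_Ici 1)
      (fun x hx => (hWd x (zero_lt_one.trans_le hx)).continuousAt.continuousWithinAt) ?_ ?_
    · intro x hx
      rw [interior_Ici] at hx
      exact (hWd x (zero_lt_one.trans hx)).differentiableAt.differentiableWithinAt
    · intro x hx
      rw [interior_Ici] at hx
      have hx' : 0 < x := zero_lt_one.trans hx
      rw [(hWd x hx').deriv]
      exact mul_nonpos_of_nonpos_of_nonneg (sub_nonpos.2 (hEb x hx')) (Real.exp_pos _).le
  refine ⟨√(W 1), Real.sqrt_nonneg _, fun x hx => Real.le_sqrt_of_sq_le ?_⟩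
  calc ‖y x‖ ^ 2 ≤ E x := le_add_of_nonneg_right (by positivity)
    _ ≤ W x := le_mul_of_one_le_right (by positivity) (Real.one_le_exp (by positivity))
    _ ≤ W 1 := hanti self_mem_Ici hx hx

/-! ### The weight `x^α J_m(ωx)` and its primitive. -/

/-- Isolates the singularity at `0` as `x^(α+m)` times a continuous function. -/
theorem rpow_mul_besselJ (α : ℝ) (m : ℂ) {ω x : ℝ} (hω : 0 < ω) (hx : 0 < x) :
    ((x ^ α : ℝ) : ℂ) * besselJ m ((ω * x : ℝ) : ℂ) =
      (x : ℂ) ^ (α + m) * ((ω / 2 : ℂ) ^ m * besselSeries m ((ω * x / 2 : ℂ) ^ 2)) := by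
  have hx0 : (x : ℂ) ≠ 0 := by exact_mod_cast hx.ne'
  have h : ((ω * x : ℝ) : ℂ) / 2 = ((ω / 2 : ℝ) : ℂ) * (x : ℂ) := by push_cast; ring
  have h' : ((ω : ℂ) * x) / 2 = ((ω / 2 : ℝ) : ℂ) * (x : ℂ) := by push_cast; ring
  rw [besselJ_eq, ofReal_cpow hx.le, cpow_add _ _ hx0, h, h',
    mul_cpow_ofReal_nonneg (by positivity) hx.le]
  push_cast
  ring

theorem continuous_besselSeries_scaled {m : ℂ} (hm : -1 < m.re) (ω : ℝ) :
    Continuous fun x : ℝ => (ω / 2 : ℂ) ^ m * besselSeries m ((ω * x / 2 : ℂ) ^ 2) :=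
  continuous_const.mul ((continuous_besselSeries hm).comp
    (by fun_prop : Continuous fun x : ℝ => (ω * x / 2 : ℂ) ^ 2))

theorem intervalIntegrable_rpow_mul_besselJ {α : ℝ} {m : ℂ} (hm : -1 < m.re)
    (hαm : -1 < α + m.re) {ω b : ℝ} (hω : 0 < ω) (hb : 0 ≤ b) :
    IntervalIntegrable (fun x : ℝ => ((x ^ α : ℝ) : ℂ) * besselJ m ((ω * x : ℝ) : ℂ))
      volume 0 b := by
  have h : IntervalIntegrable (fun x : ℝ => (x : ℂ) ^ (α + m) *
      ((ω / 2 : ℂ) ^ m * besselSeries m ((ω * x / 2 : ℂ) ^ 2))) volume 0 b :=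
    (intervalIntegral.intervalIntegrable_cpow' (by simpa using hαm)).mul_continuousOn
      (continuous_besselSeries_scaled hm ω).continuousOn
  refine h.congr fun x hx => ?_
  rw [uIoc_of_le hb] at hx
  exact (rpow_mul_besselJ α m hω hx.1).symm

theorem continuousOn_rpow_mul_besselJ (α : ℝ) {m : ℂ} (hm : -1 < m.re) {ω : ℝ} (hω : 0 < ω) :
    ContinuousOn (fun x : ℝ => ((x ^ α : ℝ) : ℂ) * besselJ m ((ω * x : ℝ) : ℂ)) (Ioi 0) := by
  refine ContinuousOn.mul ?_ ?_
  · exact continuous_ofReal.comp_continuousOn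
      (continuousOn_id.rpow_const fun x hx => Or.inl (ne_of_gt hx))
  · exact (continuousOn_besselJ hm).comp (by fun_prop) fun x hx => mul_pos hω hx

theorem hasDerivAt_rpow_mul_besselJ_add_one (β : ℝ) {m : ℂ} (hm : -1 < m.re) {ω x : ℝ}
    (hω : 0 < ω) (hx : 0 < x) :
    HasDerivAt (fun x : ℝ => ((x ^ β : ℝ) : ℂ) * besselJ (m + 1) ((ω * x : ℝ) : ℂ))
      (ω * (((x ^ β : ℝ) : ℂ) * besselJ m ((ω * x : ℝ) : ℂ)) +
        (β - m - 1) * (((x ^ (β - 1) : ℝ) : ℂ) * besselJ (m + 1) ((ω * x : ℝ) : ℂ))) x := by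
  have hx0 : (x : ℂ) ≠ 0 := by exact_mod_cast hx.ne'
  have hω0 : (ω : ℂ) ≠ 0 := by exact_mod_cast hω.ne'
  have h1 := (Real.hasDerivAt_rpow_const (p := β) (Or.inl hx.ne')).ofReal_comp
  have h2 := (hasDerivAt_besselJ_add_one hm (mul_pos hω hx)).scomp x
    ((hasDerivAt_id x).const_mul ω)
  convert! h1.mul h2 using 1
  have h3 : x ^ β = x * x ^ (β - 1) := by
    rw [Real.rpow_sub_one hx.ne']
    field_simp
  rw [h3]
  simp only [Function.comp_apply, real_smul]
  push_cast
  field_simp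
  ring

theorem intervalIntegrable_rpow_mul_besselJ_of_pos (β : ℝ) {m : ℂ} (hm : -1 < m.re) {a X : ℝ}
    (ha : 0 < a) (hX : a ≤ X) :
    IntervalIntegrable (fun s : ℝ => ((s ^ β : ℝ) : ℂ) * besselJ m s) volume a X := by
  have h := continuousOn_rpow_mul_besselJ β hm one_pos
  simp only [one_mul] at h
  refine (h.mono ?_).intervalIntegrable
  rw [uIcc_of_le hX]
  exact fun x hx => ha.trans_le hx.1

/-- One integration by parts lowers the exponent and raises the order; `C(1 + X^β)` bounds the
boundary terms. -/
theorem norm_integral_rpow_mul_besselJ_le (β : ℝ) {m : ℂ} (hm : -1 < m.re) :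
    ∃ C : ℝ, 0 ≤ C ∧ ∀ X : ℝ, 1 ≤ X →
      ‖∫ s in (1 : ℝ)..X, ((s ^ β : ℝ) : ℂ) * besselJ m s‖ ≤
        C * (1 + X ^ β) +
          ‖β - m - 1‖ * ‖∫ s in (1 : ℝ)..X, ((s ^ (β - 1) : ℝ) : ℂ) * besselJ (m + 1) s‖ := by
  have hm1 : -1 < (m + 1).re := by simp; linarith
  obtain ⟨C, hC0, hC⟩ := exists_norm_besselJ_le hm1
  refine ⟨C, hC0, fun X hX => ?_⟩
  have hi := intervalIntegrable_rpow_mul_besselJ_of_pos β hm one_pos hX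
  have hi1 := intervalIntegrable_rpow_mul_besselJ_of_pos (β - 1) hm1 one_pos hX
  have h := intervalIntegral.integral_eq_sub_of_hasDerivAt (a := 1) (b := X)
    (f := fun s : ℝ => ((s ^ β : ℝ) : ℂ) * besselJ (m + 1) s)
    (f' := fun s : ℝ => ((s ^ β : ℝ) : ℂ) * besselJ m s +
      (β - m - 1) * (((s ^ (β - 1) : ℝ) : ℂ) * besselJ (m + 1) s))
    (fun s hs => by
      rw [uIcc_of_le hX] at hs
      have := hasDerivAt_rpow_mul_besselJ_add_one β hm one_pos (zero_lt_one.trans_le hs.1)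
      simpa only [one_mul, ofReal_one] using this)
    (hi.add (hi1.const_mul _))
  rw [intervalIntegral.integral_add hi (hi1.const_mul _),
    intervalIntegral.integral_const_mul] at h
  rw [eq_sub_of_add_eq h]
  refine (norm_sub_le _ _).trans (add_le_add ((norm_sub_le _ _).trans ?_) (norm_mul_le _ _))
  have h0 : 0 ≤ X ^ β := by positivity
  have h1 := hC X hX
  have h2 := hC 1 le_rfl
  rw [norm_mul, norm_real, Real.norm_of_nonneg h0, Real.one_rpow, ofReal_one, one_mul]
  rw [ofReal_one] at h2
  nlinarith [mul_le_mul_of_nonneg_left h1 h0]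

/-- The remaining integral is bounded absolutely through `∫ s^(β-1) = (X^β - 1)/β`; at `β = 0` this
would cost a logarithm. -/
theorem exists_norm_integral_rpow_mul_besselJ_le_of_ne_zero {β : ℝ} (hβ : β ≠ 0) {m : ℂ}
    (hm : -1 < m.re) :
    ∃ C : ℝ, 0 ≤ C ∧ ∀ X : ℝ, 1 ≤ X →
      ‖∫ s in (1 : ℝ)..X, ((s ^ β : ℝ) : ℂ) * besselJ m s‖ ≤ C * (1 + X ^ β) := by
  have hm1 : -1 < (m + 1).re := by simp; linarith
  obtain ⟨C, hC0, hC⟩ := norm_integral_rpow_mul_besselJ_le β hm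
  obtain ⟨D, hD0, hD⟩ := exists_norm_besselJ_le hm1
  refine ⟨C + ‖β - m - 1‖ * (D / |β|), by positivity, fun X hX => (hC X hX).trans ?_⟩
  have hX0 : 0 ≤ X ^ β := by positivity
  have h0 : (0 : ℝ) ∉ uIcc 1 X := by
    rw [uIcc_of_le hX]
    exact fun h => absurd h.1 (by norm_num)
  have hint : ∫ s in (1 : ℝ)..X, s ^ (β - 1) = (X ^ β - 1) / β := by
    rw [integral_rpow (Or.inr ⟨by simpa using hβ, h0⟩), sub_add_cancel, Real.one_rpow]
  have h1 : ‖∫ s in (1 : ℝ)..X, ((s ^ (β - 1) : ℝ) : ℂ) * besselJ (m + 1) s‖ ≤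
      D / |β| * (1 + X ^ β) := by
    calc _ ≤ ∫ s in (1 : ℝ)..X, s ^ (β - 1) * D := by
          refine intervalIntegral.norm_integral_le_of_norm_le hX (.of_forall fun s hs => ?_)
            ((intervalIntegral.intervalIntegrable_rpow (Or.inr h0)).mul_const D)
          have hs0 : 0 ≤ s := zero_le_one.trans hs.1.le
          rw [norm_mul, norm_real, Real.norm_of_nonneg (by positivity)]
          exact mul_le_mul_of_nonneg_left (hD s hs.1.le) (by positivity)
      _ ≤ |(X ^ β - 1) / β| * D := by
          rw [intervalIntegral.integral_mul_const, hint]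
          exact mul_le_mul_of_nonneg_right (le_abs_self _) hD0
      _ ≤ (1 + X ^ β) / |β| * D := by
          rw [abs_div]
          gcongr
          exact abs_le.2 ⟨by linarith, by linarith⟩
      _ = _ := by ring
  nlinarith [mul_le_mul_of_nonneg_left h1 (norm_nonneg ((β : ℂ) - m - 1))]

theorem exists_norm_integral_rpow_mul_besselJ_le (β : ℝ) {m : ℂ} (hm : -1 < m.re) :
    ∃ C : ℝ, 0 ≤ C ∧ ∀ X : ℝ, 1 ≤ X →
      ‖∫ s in (1 : ℝ)..X, ((s ^ β : ℝ) : ℂ) * besselJ m s‖ ≤ C * (1 + X ^ β) := by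
  rcases eq_or_ne β 0 with rfl | hβ
  · obtain ⟨C, hC0, hC⟩ := norm_integral_rpow_mul_besselJ_le 0 hm
    -- For `β = 0` a second integration by parts, now at exponent `-1`, avoids the logarithm.
    obtain ⟨D, hD0, hD⟩ := exists_norm_integral_rpow_mul_besselJ_le_of_ne_zero (β := 0 - 1)
      (by norm_num) (m := m + 1) (by simp; linarith)
    refine ⟨C + ‖((0 : ℝ) : ℂ) - m - 1‖ * D, by positivity, fun X hX => (hC X hX).trans ?_⟩
    have h1 : X ^ (0 - 1 : ℝ) ≤ X ^ (0 : ℝ) := Real.rpow_le_rpow_of_exponent_le hX (by norm_num)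
    have h2 := (hD X hX).trans
      (mul_le_mul_of_nonneg_left (by linarith : 1 + X ^ (0 - 1 : ℝ) ≤ 1 + X ^ (0 : ℝ)) hD0)
    nlinarith [mul_le_mul_of_nonneg_left h2 (norm_nonneg (((0 : ℝ) : ℂ) - m - 1))]
  · exact exists_norm_integral_rpow_mul_besselJ_le_of_ne_zero hβ hm

theorem exists_norm_integral_zero_rpow_mul_besselJ_le {α : ℝ} {m : ℂ} (hm : -1 < m.re)
    (hαm : -1 < α + m.re) :
    ∃ C : ℝ, 0 ≤ C ∧ ∀ X : ℝ, 0 ≤ X →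
      ‖∫ s in (0 : ℝ)..X, ((s ^ α : ℝ) : ℂ) * besselJ m s‖ ≤ C * (1 + max 1 X ^ α) := by
  obtain ⟨C, hC0, hC⟩ := exists_norm_integral_rpow_mul_besselJ_le α hm
  have hi : ∀ X : ℝ, 0 ≤ X →
      IntervalIntegrable (fun s : ℝ => ((s ^ α : ℝ) : ℂ) * besselJ m s) volume 0 X := fun X hX => by
    simpa only [one_mul] using intervalIntegrable_rpow_mul_besselJ hm hαm one_pos hX
  set K := ∫ s in (0 : ℝ)..1, ‖((s ^ α : ℝ) : ℂ) * besselJ m s‖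
  have hK : 0 ≤ K := intervalIntegral.integral_nonneg zero_le_one fun _ _ => norm_nonneg _
  have hle : ∀ X : ℝ, 0 ≤ X → X ≤ 1 →
      ‖∫ s in (0 : ℝ)..X, ((s ^ α : ℝ) : ℂ) * besselJ m s‖ ≤ K := fun X hX hX1 =>
    (intervalIntegral.norm_integral_le_integral_norm hX).trans
      (intervalIntegral.integral_mono_interval le_rfl hX hX1
        (.of_forall fun _ => norm_nonneg _) (hi 1 zero_le_one).norm)
  refine ⟨K + C, by positivity, fun X hX => ?_⟩
  have hM : 0 ≤ max 1 X ^ α := by positivity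
  rcases le_total X 1 with h1 | h1
  · nlinarith [hle X hX h1, mul_nonneg hK hM, mul_nonneg hC0 hM]
  · rw [← intervalIntegral.integral_add_adjacent_intervals (hi 1 zero_le_one)
      (intervalIntegrable_rpow_mul_besselJ_of_pos α hm one_pos h1)]
    rw [max_eq_right h1] at hM ⊢
    refine (norm_add_le _ _).trans ?_
    nlinarith [hle 1 zero_le_one le_rfl, hC X h1, mul_nonneg hK hM]

theorem integral_rpow_mul_besselJ_scaled (α : ℝ) (m : ℂ) {ω x : ℝ} (hω : 0 < ω) (hx : 0 ≤ x) :
    ∫ t in (0 : ℝ)..x, ((t ^ α : ℝ) : ℂ) * besselJ m ((ω * t : ℝ) : ℂ) =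
      ((ω ^ (α + 1))⁻¹ : ℝ) *
        ∫ s in (0 : ℝ)..(ω * x), ((s ^ α : ℝ) : ℂ) * besselJ m s := by
  have h := intervalIntegral.integral_comp_mul_left (a := 0) (b := x)
    (fun s : ℝ => ((s ^ α : ℝ) : ℂ) * besselJ m s) hω.ne'
  rw [mul_zero] at h
  have h2 : ∫ t in (0 : ℝ)..x, ((t ^ α : ℝ) : ℂ) * besselJ m ((ω * t : ℝ) : ℂ) =
      ∫ t in (0 : ℝ)..x, (((ω ^ α)⁻¹ : ℝ) : ℂ) *
        ((((ω * t) ^ α : ℝ) : ℂ) * besselJ m ((ω * t : ℝ) : ℂ)) := by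
    refine intervalIntegral.integral_congr_ae (.of_forall fun t ht => ?_)
    rw [uIoc_of_le hx] at ht
    have hp : ((ω ^ α : ℝ) : ℂ) ≠ 0 := by exact_mod_cast (Real.rpow_pos_of_pos hω α).ne'
    rw [Real.mul_rpow hω.le ht.1.le]
    push_cast
    field_simp
  rw [h2, intervalIntegral.integral_const_mul, h, real_smul, ← mul_assoc, ← ofReal_mul,
    Real.rpow_add_one hω.ne', mul_inv]

/-- The constant `C₁` bounds the antiderivative of the oscillatory weight. -/
theorem exists_norm_integral_le_C₁ (b : ℝ) {α : ℝ} {m : ℂ} (hm : -1 < m.re)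
    (hαm : -1 < α + m.re) :
    ∃ c : ℝ, 0 ≤ c ∧ ∀ ω : ℝ, 1 ≤ ω → ∀ x ∈ Icc 0 b,
      ‖∫ t in (0 : ℝ)..x, ((t ^ α : ℝ) : ℂ) * besselJ m ((ω * t : ℝ) : ℂ)‖ ≤ C₁ c α ω := by
  obtain ⟨C, hC0, hC⟩ := exists_norm_integral_zero_rpow_mul_besselJ_le hm hαm
  have hM : 0 ≤ max 1 b ^ α := by positivity
  -- This constant serves both signs of `α`: `max(1,ωx)^α` is at most `1` if `α < 0` and at most
  -- `ω^α max(1,b)^α` otherwise, where `ω^α/ω^(α+1) = 1/ω`.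
  refine ⟨C * (2 + max 1 b ^ α), by positivity, fun ω hω x hx => ?_⟩
  have hω0 : 0 < ω := zero_lt_one.trans_le hω
  have h := hC (ω * x) (mul_nonneg hω0.le hx.1)
  rw [integral_rpow_mul_besselJ_scaled α m hω0 hx.1, norm_mul, norm_real,
    Real.norm_of_nonneg (by positivity)]
  have hp : 0 < ω ^ (α + 1) := Real.rpow_pos_of_pos hω0 _
  rw [C₁]
  split_ifs with hα
  · rw [div_eq_inv_mul]
    refine mul_le_mul_of_nonneg_left (h.trans ?_) (by positivity)
    have h1 : max 1 (ω * x) ^ α ≤ 1 :=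
      Real.rpow_le_one_of_one_le_of_nonpos (le_max_left _ _) hα.le
    exact mul_le_mul_of_nonneg_left (by linarith) hC0
  · have hα' : 0 ≤ α := not_lt.1 hα
    have h1 : 1 ≤ ω ^ α := Real.one_le_rpow hω hα'
    have h2 : max 1 (ω * x) ^ α ≤ ω ^ α * max 1 b ^ α := by
      rw [← Real.mul_rpow hω0.le (by positivity)]
      refine Real.rpow_le_rpow (by positivity) (max_le ?_ ?_) hα'
      · exact one_le_mul_of_one_le_of_one_le hω (le_max_left _ _)
      · exact mul_le_mul_of_nonneg_left (hx.2.trans (le_max_right _ _)) hω0.le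
    rw [Real.rpow_add_one hω0.ne', inv_mul_le_iff₀ (by positivity)]
    calc _ ≤ _ := h
      _ ≤ C * (ω ^ α * (2 + max 1 b ^ α)) := mul_le_mul_of_nonneg_left (by nlinarith) hC0
      _ = _ := by field_simp

/-! ### Integration by parts with one and with two derivatives of the error. -/

/-- Integration by parts against an antiderivative of `φ` that is bounded by `M`. -/
theorem norm_integral_mul_le_of_primitive_le {b K M : ℝ} (hb : 0 < b) {φ g g' : ℝ → ℂ}
    (hφ : IntervalIntegrable φ volume 0 b) (hφc : ContinuousOn φ (Ioo 0 b))
    (hM : ∀ x ∈ Icc 0 b, ‖∫ t in (0 : ℝ)..x, φ t‖ ≤ M)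
    (hg : ContinuousOn g (Icc 0 b)) (hg' : ∀ x ∈ Ioo 0 b, HasDerivAt g (g' x) x)
    (hg'c : ContinuousOn g' (Ioo 0 b)) (hK : ∀ x ∈ Ioo 0 b, ‖g' x‖ ≤ K) :
    ‖∫ x in (0 : ℝ)..b, g x * φ x‖ ≤ M * (‖g b‖ + b * K) := by
  have hK0 : 0 ≤ K := (norm_nonneg _).trans (hK (b / 2) ⟨by linarith, by linarith⟩)
  set F : ℝ → ℂ := fun x => ∫ t in (0 : ℝ)..x, φ t
  have hφ0 : IntegrableOn φ (uIcc 0 b) := by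
    rwa [uIcc_of_le hb.le, ← intervalIntegrable_iff_integrableOn_Icc_of_le hb.le]
  have hF : ContinuousOn F (uIcc 0 b) := intervalIntegral.continuousOn_primitive_interval hφ0
  have hF' : ∀ x ∈ Ioo 0 b, HasDerivAt F (φ x) x := fun x hx =>
    intervalIntegral.integral_hasDerivAt_right
      (hφ.mono_set (uIcc_subset_uIcc left_mem_uIcc (uIcc_of_le hb.le ▸ Ioo_subset_Icc_self hx)))
      (hφc.stronglyMeasurableAtFilter isOpen_Ioo x hx) (hφc.continuousAt (isOpen_Ioo.mem_nhds hx))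
  have hg'i : IntervalIntegrable g' volume 0 b := by
    rw [intervalIntegrable_iff_integrableOn_Ioo_of_le hb.le]
    exact IntegrableOn.of_bound measure_Ioo_lt_top (hg'c.aestronglyMeasurable measurableSet_Ioo) K
      ((ae_restrict_iff' measurableSet_Ioo).2 (.of_forall hK))
  have hparts := intervalIntegral.integral_mul_deriv_eq_deriv_mul_of_hasDerivAt
    (a := 0) (b := b) (u := g) (v := F) (u' := g') (v' := φ) (by rwa [uIcc_of_le hb.le]) hF
    (by rwa [min_eq_left hb.le, max_eq_right hb.le])
    (by rwa [min_eq_left hb.le, max_eq_right hb.le]) hg'i hφ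
  have hF0 : F 0 = 0 := intervalIntegral.integral_same
  rw [hparts, hF0, mul_zero, sub_zero]
  have h1 : ‖∫ x in (0 : ℝ)..b, g' x * F x‖ ≤ K * M * |b - 0| := by
    have hM0 : 0 ≤ M := (norm_nonneg _).trans (hM 0 ⟨le_rfl, hb.le⟩)
    refine intervalIntegral.norm_integral_le_of_norm_le_const_ae ?_
    filter_upwards [compl_mem_ae_iff.2 (measure_singleton b)] with x hxb hx
    rw [uIoc_of_le hb.le] at hx
    have hx' : x ∈ Ioo 0 b := ⟨hx.1, lt_of_le_of_ne hx.2 hxb⟩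
    rw [norm_mul]
    exact mul_le_mul (hK x hx') (hM x (Ioo_subset_Icc_self hx')) (norm_nonneg _) hK0
  rw [sub_zero, abs_of_pos hb] at h1
  have h2 : ‖g b * F b‖ ≤ ‖g b‖ * M := by
    rw [norm_mul]
    exact mul_le_mul_of_nonneg_left (hM b ⟨hb.le, le_rfl⟩) (norm_nonneg _)
  calc _ ≤ _ := norm_sub_le _ _
    _ ≤ ‖g b‖ * M + K * M * b := add_le_add h2 h1
    _ = _ := by ring

/-- The function `e x / x`, extended to `0` by the value `d`. -/
noncomputable def divId (e : ℝ → ℂ) (d : ℂ) : ℝ → ℂ :=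
  Function.update (fun x => e x / x) 0 d

theorem divId_of_ne_zero (e : ℝ → ℂ) (d : ℂ) {x : ℝ} (hx : x ≠ 0) : divId e d x = e x / x :=
  Function.update_of_ne hx _ _

theorem continuousOn_divId {b : ℝ} {e e₁ : ℝ → ℂ} (he0 : e 0 = 0)
    (he : ∀ x ∈ Icc 0 b, HasDerivWithinAt e (e₁ x) (Icc 0 b) x) :
    ContinuousOn (divId e (e₁ 0)) (Icc 0 b) := by
  intro x hx
  rcases eq_or_ne x 0 with rfl | hx0
  · refine continuousWithinAt_update_same.2 ?_
    refine (hasDerivWithinAt_iff_tendsto_slope.1 (he 0 hx)).congr' ?_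
    filter_upwards [self_mem_nhdsWithin] with t ht
    rw [slope_def_module, he0, sub_zero, sub_zero, real_smul, div_eq_inv_mul, ofReal_inv]
  · have hxc : (x : ℂ) ≠ 0 := by exact_mod_cast hx0
    refine (continuousWithinAt_update_of_ne hx0).2 ?_
    exact (he x hx).continuousWithinAt.div continuous_ofReal.continuousWithinAt hxc

theorem hasDerivAt_divId {e : ℝ → ℂ} (d : ℂ) {d₁ : ℂ} {x : ℝ} (hx : 0 < x)
    (he : HasDerivAt e d₁ x) : HasDerivAt (divId e d) ((x * d₁ - e x) / x ^ 2) x := by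
  have hxc : (x : ℂ) ≠ 0 := by exact_mod_cast hx.ne'
  have h := he.div (hasDerivAt_id (x : ℂ)).comp_ofReal hxc
  have h2 : HasDerivAt (fun x : ℝ => e x / (x : ℂ)) ((x * d₁ - e x) / x ^ 2) x := by
    convert! h using 1
    simp
    ring
  refine h2.congr_of_eventuallyEq ?_
  filter_upwards [lt_mem_nhds hx] with t ht using divId_of_ne_zero e d ht.ne'

/-- The function `x e' - e` vanishes at `0` and has derivative `x e''`. Divided by `x²` it is the
derivative of `e/x`, which is therefore bounded by `K`; the sharper `K/2` is not needed. -/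
theorem norm_mul_deriv_sub_le {b K : ℝ} {e e₁ e₂ : ℝ → ℂ} (he0 : e 0 = 0)
    (he : ∀ x ∈ Icc 0 b, HasDerivWithinAt e (e₁ x) (Icc 0 b) x)
    (he₁ : ∀ x ∈ Icc 0 b, HasDerivWithinAt e₁ (e₂ x) (Icc 0 b) x)
    (hK : ∀ x ∈ Icc 0 b, ‖e₂ x‖ ≤ K) {x : ℝ} (hx : x ∈ Icc 0 b) :
    ‖x * e₁ x - e x‖ ≤ K * x ^ 2 := by
  have hsub : Icc 0 x ⊆ Icc 0 b := Icc_subset_Icc_right hx.2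
  have hd : ∀ t ∈ Icc 0 x, HasDerivWithinAt (fun t : ℝ => (t : ℂ) * e₁ t - e t)
      (t * e₂ t) (Icc 0 x) t := fun t ht => by
    have h1 := (hasDerivAt_id (t : ℂ)).comp_ofReal.hasDerivWithinAt (s := Icc 0 x)
    have h2 := (he₁ t (hsub ht)).mono hsub
    have h3 := (he t (hsub ht)).mono hsub
    convert! (h1.mul h2).sub h3 using 1
    simp
  have h := norm_image_sub_le_of_norm_deriv_le_segment' (C := x * K) hd (fun t ht => by
    rw [norm_mul, norm_real, Real.norm_of_nonneg ht.1]
    exact mul_le_mul ht.2.le (hK t (hsub (Ico_subset_Icc_self ht))) (norm_nonneg _) hx.1)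
    x ⟨hx.1, le_rfl⟩
  simp only [he0, ofReal_zero, zero_mul, sub_zero] at h
  linarith

/-- Integrate the derivative of `x^α J_{m+1}(ωx) e(x)`. Both boundary values vanish, and `x^(α-1) e`
is read as `x^α (e/x)` so that the same weight appears. -/
theorem mul_integral_rpow_mul_besselJ {b α ω : ℝ} {m : ℂ} (hb : 0 < b) (hm : -1 < m.re)
    (hαm : -1 < α + m.re) (hω : 0 < ω) {e e₁ : ℝ → ℂ} (he0 : e 0 = 0) (heb : e b = 0)
    (he : ∀ x ∈ Icc 0 b, HasDerivWithinAt e (e₁ x) (Icc 0 b) x)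
    (he₁ : ContinuousOn e₁ (Icc 0 b)) :
    ω * ∫ x in (0 : ℝ)..b, e x * (((x ^ α : ℝ) : ℂ) * besselJ m ((ω * x : ℝ) : ℂ)) =
      -∫ x in (0 : ℝ)..b, (e₁ x + (α - m - 1) * divId e (e₁ 0) x) *
        (((x ^ α : ℝ) : ℂ) * besselJ (m + 1) ((ω * x : ℝ) : ℂ)) := by
  have hm1 : -1 < (m + 1).re := by simp; linarith
  have hαm1 : -1 < α + (m + 1).re := by simp; linarith
  have hq := continuousOn_divId he0 he
  have hec : ContinuousOn e (Icc 0 b) := fun x hx => (he x hx).continuousWithinAt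
  have hg : ContinuousOn (fun x => e₁ x + (α - m - 1) * divId e (e₁ 0) x) (Icc 0 b) :=
    he₁.add (continuousOn_const.mul hq)
  set h : ℝ → ℂ := fun x => (((x ^ α : ℝ) : ℂ) * besselJ (m + 1) ((ω * x : ℝ) : ℂ)) * e x
  have hs : α + (m + 1) + 1 ≠ 0 := fun h => by
    have := congrArg re h
    simp at this
    linarith
  have hsre : 0 < (α + (m + 1) + 1 : ℂ).re := by simp; linarith
  have hcont : ContinuousOn h (Icc 0 b) := by
    -- The weight may be singular at `0`; taking a factor `x` out of `e` raises the exponent to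
    -- `α+m+2`, of positive real part.
    have hc : ContinuousOn (fun x : ℝ => (x : ℂ) ^ (α + (m + 1) + 1) *
        ((ω / 2 : ℂ) ^ (m + 1) * besselSeries (m + 1) ((ω * x / 2 : ℂ) ^ 2)) *
        divId e (e₁ 0) x) (Icc 0 b) :=
      ((continuous_ofReal_cpow_const hsre).continuousOn.mul
        (continuous_besselSeries_scaled hm1 ω).continuousOn).mul hq
    refine hc.congr fun x hx => ?_
    rcases hx.1.eq_or_lt with rfl | hx0
    · simp only [h, he0, ofReal_zero, zero_cpow hs, mul_zero, zero_mul]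
    · have hxc : (x : ℂ) ≠ 0 := by exact_mod_cast hx0.ne'
      simp only [h]
      rw [rpow_mul_besselJ α (m + 1) hω hx0, divId_of_ne_zero _ _ hx0.ne',
        cpow_add (α + (m + 1) : ℂ) 1 hxc, cpow_one]
      field_simp
  have hw := intervalIntegrable_rpow_mul_besselJ hm hαm hω hb.le
  have hw1 := intervalIntegrable_rpow_mul_besselJ hm1 hαm1 hω hb.le
  have hI := hw.continuousOn_mul (g := e) (by rwa [uIcc_of_le hb.le])
  have hI1 := hw1.continuousOn_mul
    (g := fun x => e₁ x + (α - m - 1) * divId e (e₁ 0) x) (by rwa [uIcc_of_le hb.le])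
  have hft := intervalIntegral.integral_eq_sub_of_hasDerivAt_of_le hb.le hcont
    (f' := fun x => ω * (e x * (((x ^ α : ℝ) : ℂ) * besselJ m ((ω * x : ℝ) : ℂ))) +
      (e₁ x + (α - m - 1) * divId e (e₁ 0) x) *
        (((x ^ α : ℝ) : ℂ) * besselJ (m + 1) ((ω * x : ℝ) : ℂ)))
    (fun x hx => by
      have hxc : (x : ℂ) ≠ 0 := by exact_mod_cast hx.1.ne'
      have h1 := hasDerivAt_rpow_mul_besselJ_add_one α hm hω hx.1
      have h2 := (he x (Ioo_subset_Icc_self hx)).hasDerivAt (Icc_mem_nhds hx.1 hx.2)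
      convert! h1.mul h2 using 1
      rw [divId_of_ne_zero _ _ hx.1.ne', Real.rpow_sub_one hx.1.ne']
      push_cast
      field_simp
      ring)
    ((hI.const_mul _).add hI1)
  rw [intervalIntegral.integral_add (hI.const_mul _) hI1, intervalIntegral.integral_const_mul] at hft
  have h0 : h b - h 0 = 0 := by simp only [h, he0, heb, mul_zero, sub_zero]
  rw [h0] at hft
  exact eq_neg_of_add_eq_zero_left hft

theorem norm_integral_rpow_mul_besselJ_le_deriv {b α ω K M : ℝ} {m : ℂ} (hb : 0 < b)
    (hm : -1 < m.re) (hαm : -1 < α + m.re) (hω : 0 < ω)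
    (hM : ∀ x ∈ Icc 0 b,
      ‖∫ t in (0 : ℝ)..x, ((t ^ α : ℝ) : ℂ) * besselJ m ((ω * t : ℝ) : ℂ)‖ ≤ M)
    {g g' : ℝ → ℂ} (hg : ContinuousOn g (Icc 0 b)) (hg' : ∀ x ∈ Ioo 0 b, HasDerivAt g (g' x) x)
    (hg'c : ContinuousOn g' (Ioo 0 b)) (hK : ∀ x ∈ Ioo 0 b, ‖g' x‖ ≤ K) :
    ‖∫ x in (0 : ℝ)..b, g x * (((x ^ α : ℝ) : ℂ) * besselJ m ((ω * x : ℝ) : ℂ))‖ ≤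
      M * (‖g b‖ + b * K) :=
  norm_integral_mul_le_of_primitive_le hb
    (intervalIntegrable_rpow_mul_besselJ hm hαm hω hb.le)
    ((continuousOn_rpow_mul_besselJ α hm hω).mono fun _ hx => hx.1) hM hg hg' hg'c hK

theorem norm_integral_rpow_mul_besselJ_le_second_deriv {b α ω K M : ℝ} {m : ℂ} (hb : 0 < b)
    (hm : -1 < m.re) (hαm : -1 < α + m.re) (hω : 0 < ω)
    (hM : ∀ x ∈ Icc 0 b,
      ‖∫ t in (0 : ℝ)..x, ((t ^ α : ℝ) : ℂ) * besselJ (m + 1) ((ω * t : ℝ) : ℂ)‖ ≤ M)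
    {e e₁ e₂ : ℝ → ℂ} (he0 : e 0 = 0) (heb : e b = 0)
    (he : ∀ x ∈ Icc 0 b, HasDerivWithinAt e (e₁ x) (Icc 0 b) x)
    (he₁ : ∀ x ∈ Icc 0 b, HasDerivWithinAt e₁ (e₂ x) (Icc 0 b) x)
    (he₂ : ContinuousOn e₂ (Icc 0 b)) (hK : ∀ x ∈ Icc 0 b, ‖e₂ x‖ ≤ K) :
    ‖∫ x in (0 : ℝ)..b, e x * (((x ^ α : ℝ) : ℂ) * besselJ m ((ω * x : ℝ) : ℂ))‖ ≤
      M / ω * (‖e₁ b‖ + b * ((1 + ‖(α : ℂ) - m - 1‖) * K)) := by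
  have hec : ContinuousOn e (Icc 0 b) := fun x hx => (he x hx).continuousWithinAt
  have he₁c : ContinuousOn e₁ (Icc 0 b) := fun x hx => (he₁ x hx).continuousWithinAt
  have hxc : ∀ x ∈ Ioo 0 b, (x : ℂ) ≠ 0 := fun x hx => by exact_mod_cast hx.1.ne'
  have hd : ∀ x ∈ Ioo 0 b, HasDerivAt (fun x => e₁ x + (α - m - 1) * divId e (e₁ 0) x)
      (e₂ x + (α - m - 1) * ((x * e₁ x - e x) / x ^ 2)) x := fun x hx => by
    have hx' := Ioo_subset_Icc_self hx
    have hn := Icc_mem_nhds hx.1 hx.2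
    exact ((he₁ x hx').hasDerivAt hn).add
      ((hasDerivAt_divId _ hx.1 ((he x hx').hasDerivAt hn)).const_mul _)
  have hdc : ContinuousOn (fun x : ℝ => e₂ x + (α - m - 1) * ((x * e₁ x - e x) / x ^ 2))
      (Ioo 0 b) := by
    have hsub : Ioo 0 b ⊆ Icc 0 b := Ioo_subset_Icc_self
    have hid : ContinuousOn (fun x : ℝ => (x : ℂ)) (Ioo 0 b) := continuous_ofReal.continuousOn
    exact (he₂.mono hsub).add (continuousOn_const.mul
      (((hid.mul (he₁c.mono hsub)).sub (hec.mono hsub)).div (hid.pow 2)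
        fun x hx => pow_ne_zero 2 (hxc x hx)))
  have hdK : ∀ x ∈ Ioo 0 b, ‖e₂ x + (α - m - 1) * ((x * e₁ x - e x) / x ^ 2)‖ ≤
      (1 + ‖(α : ℂ) - m - 1‖) * K := fun x hx => by
    have hx' := Ioo_subset_Icc_self hx
    have h1 := norm_mul_deriv_sub_le he0 he he₁ hK hx'
    have h2 : ‖((x : ℂ) * e₁ x - e x) / x ^ 2‖ ≤ K := by
      rw [norm_div, norm_pow, norm_real, Real.norm_of_nonneg hx.1.le]
      exact (div_le_iff₀ (by have := hx.1; positivity)).2 h1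
    calc _ ≤ ‖e₂ x‖ + ‖(α : ℂ) - m - 1‖ * ‖((x : ℂ) * e₁ x - e x) / x ^ 2‖ :=
          (norm_add_le _ _).trans_eq (by rw [norm_mul])
      _ ≤ K + ‖(α : ℂ) - m - 1‖ * K :=
          add_le_add (hK x hx') (mul_le_mul_of_nonneg_left h2 (norm_nonneg _))
      _ = _ := by ring
  have h := norm_integral_rpow_mul_besselJ_le_deriv hb (m := m + 1) (by simp; linarith)
    (by simp; linarith) hω hM (he₁c.add (continuousOn_const.mul (continuousOn_divId he0 he)))
    hd hdc hdK
  -- Because `e(b) = 0`, only `e'(b)` survives in the boundary term.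
  have hqb : divId e (e₁ 0) b = 0 := by rw [divId_of_ne_zero _ _ hb.ne', heb, zero_div]
  have hparts := congrArg norm (mul_integral_rpow_mul_besselJ hb hm hαm hω he0 heb he he₁c)
  rw [norm_mul, norm_neg, norm_real, Real.norm_of_nonneg hω.le] at hparts
  rw [div_mul_eq_mul_div, le_div_iff₀ hω, mul_comm, hparts]
  simpa only [Pi.add_apply, Pi.mul_apply, hqb, mul_zero, add_zero] using h

/-! ### The bound without derivatives. -/

theorem norm_integral_rpow_mul_besselJ_le_sup {b α ω ν K : ℝ} (hb : 0 < b) (hα : -1 < α)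
    (hν : 0 ≤ ν) (hω : 0 < ω) {e : ℝ → ℂ} (hK : ∀ x ∈ Icc 0 b, ‖e x‖ ≤ K) :
    ‖∫ x in (0 : ℝ)..b, e x * (((x ^ α : ℝ) : ℂ) * besselJ ν ((ω * x : ℝ) : ℂ))‖ ≤
      b ^ (α + 1) / (α + 1) * K := by
  have hint : ∫ x in (0 : ℝ)..b, x ^ α = b ^ (α + 1) / (α + 1) := by
    rw [integral_rpow (Or.inl hα), Real.zero_rpow (by linarith), sub_zero]
  rw [← hint, ← intervalIntegral.integral_mul_const]
  refine intervalIntegral.norm_integral_le_of_norm_le hb.le (.of_forall fun x hx => ?_)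
    ((intervalIntegral.intervalIntegrable_rpow' hα).mul_const K)
  have hp : 0 ≤ x ^ α := Real.rpow_nonneg hx.1.le _
  have h1 := hK x (Ioc_subset_Icc_self hx)
  have h2 := norm_besselJ_le_one hν (mul_pos hω hx.1)
  rw [norm_mul, norm_mul, norm_real, Real.norm_of_nonneg hp]
  calc ‖e x‖ * (x ^ α * ‖besselJ ν ((ω * x : ℝ) : ℂ)‖) ≤ K * (x ^ α * 1) := by
        have := (norm_nonneg _).trans h1
        gcongr
    _ = _ := by ring

/-! ### Interpolation at the nodes and regularity of the error. -/

theorem node_injOn {b : ℝ} (hb : 0 < b) {N : ℕ} (hN : 1 ≤ N) :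
    Set.InjOn (fun k => (node b N k : ℂ)) (Finset.range (N + 1) : Set ℕ) := by
  intro i hi j hj h
  have hN0 : (0 : ℝ) < N := by exact_mod_cast hN
  have hmem : ∀ k ∈ (Finset.range (N + 1) : Set ℕ), (k * Real.pi / N : ℝ) ∈ Icc 0 Real.pi :=
    fun k hk => by
      have hk' : (k : ℝ) ≤ N := by
        exact_mod_cast Nat.lt_succ_iff.1 (Finset.mem_range.1 hk)
      refine ⟨by positivity, (div_le_iff₀ hN0).2 ?_⟩
      rw [mul_comm]
      exact mul_le_mul_of_nonneg_left hk' Real.pi_pos.le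
  have h1 : node b N i = node b N j := ofReal_injective h
  have h2 : Real.cos (i * Real.pi / N) = Real.cos (j * Real.pi / N) := by
    simp only [node] at h1
    exact mul_left_cancel₀ (half_pos hb).ne' (add_left_cancel h1)
  have h3 := Real.injOn_cos (hmem i hi) (hmem j hj) h2
  have h4 : (i : ℝ) = j := by
    field_simp at h3
    exact h3
  exact_mod_cast h4

theorem interp_eval_node {b : ℝ} (hb : 0 < b) {N : ℕ} (hN : 1 ≤ N) (f : ℝ → ℂ) {k : ℕ}
    (hk : k ≤ N) : (interp b N f).eval (node b N k : ℂ) = f (node b N k) :=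
  Lagrange.eval_interpolate_at_node _ (node_injOn hb hN)
    (Finset.mem_range.2 (Nat.lt_succ_of_le hk))

theorem node_zero (b : ℝ) (N : ℕ) : node b N 0 = b := by simp [node]

theorem node_self (b : ℝ) {N : ℕ} (hN : 1 ≤ N) : node b N N = 0 := by
  have hN0 : (N : ℝ) ≠ 0 := by exact_mod_cast (zero_lt_one.trans_le hN).ne'
  simp [node, mul_div_cancel_left₀ _ hN0]

theorem errDeriv_zero_apply (b : ℝ) (N : ℕ) (f : ℝ → ℂ) (x : ℝ) :
    errDeriv b N f 0 x = f x - (interp b N f).eval (x : ℂ) := by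
  simp [errDeriv]

theorem errDeriv_zero_left {b : ℝ} (hb : 0 < b) {N : ℕ} (hN : 1 ≤ N) (f : ℝ → ℂ) :
    errDeriv b N f 0 0 = 0 := by
  have h := interp_eval_node hb hN f le_rfl
  rw [node_self b hN] at h
  rw [errDeriv_zero_apply, h, sub_self]

theorem errDeriv_zero_right {b : ℝ} (hb : 0 < b) {N : ℕ} (hN : 1 ≤ N) (f : ℝ → ℂ) :
    errDeriv b N f 0 b = 0 := by
  have h := interp_eval_node hb hN f N.zero_le
  rw [node_zero] at h
  rw [errDeriv_zero_apply, h, sub_self]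

theorem continuousOn_errDeriv {b : ℝ} (hb : 0 < b) (N : ℕ) {f : ℝ → ℂ}
    (hf : ContDiffOn ℝ 2 f (Icc 0 b)) {j : ℕ} (hj : j ≤ 2) :
    ContinuousOn (errDeriv b N f j) (Icc 0 b) :=
  (hf.continuousOn_iteratedDerivWithin (by exact_mod_cast hj) (uniqueDiffOn_Icc hb)).sub
    ((Polynomial.continuous _).comp continuous_ofReal).continuousOn

theorem hasDerivWithinAt_errDeriv {b : ℝ} (hb : 0 < b) (N : ℕ) {f : ℝ → ℂ}
    (hf : ContDiffOn ℝ 2 f (Icc 0 b)) {j : ℕ} (hj : j < 2) {x : ℝ} (hx : x ∈ Icc 0 b) :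
    HasDerivWithinAt (errDeriv b N f j) (errDeriv b N f (j + 1) x) (Icc 0 b) x := by
  have h1 : HasDerivWithinAt (iteratedDerivWithin j f (Icc 0 b))
      (iteratedDerivWithin (j + 1) f (Icc 0 b) x) (Icc 0 b) x := by
    rw [iteratedDerivWithin_succ]
    exact (hf.differentiableOn_iteratedDerivWithin (by exact_mod_cast hj)
      (uniqueDiffOn_Icc hb) x hx).hasDerivWithinAt
  have h2 := (Polynomial.hasDerivAt (Polynomial.derivative^[j] (interp b N f))
    (x : ℂ)).comp_ofReal.hasDerivWithinAt (s := Icc 0 b)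
  rw [← Function.iterate_succ_apply' (Polynomial.derivative (R := ℂ))] at h2
  exact h1.sub h2

/-- Continuity matters: it makes the range bounded, and the supremum of an unbounded set of reals is
`0` by convention. -/
theorem norm_le_supNorm {b : ℝ} {g : ℝ → ℂ} (hg : ContinuousOn g (Icc 0 b)) {x : ℝ}
    (hx : x ∈ Icc 0 b) : ‖g x‖ ≤ supNorm b g := by
  obtain ⟨C, hC⟩ := isCompact_Icc.exists_bound_of_continuousOn hg
  exact le_ciSup (f := fun x : Icc (0 : ℝ) b => ‖g x‖)
    ⟨C, by rintro _ ⟨y, rfl⟩; exact hC y y.2⟩ ⟨x, hx⟩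

theorem besselTransform_sub_ccfRule {b α : ℝ} {m : ℂ} (hb : 0 < b) (hm : -1 < m.re)
    (hαm : -1 < α + m.re) (N : ℕ) {ω : ℝ} (hω : 0 < ω) {f : ℝ → ℂ}
    (hf : ContinuousOn f (Icc 0 b)) :
    besselTransform b α m ω f - ccfRule b α m ω N f =
      ∫ x in (0 : ℝ)..b, errDeriv b N f 0 x *
        (((x ^ α : ℝ) : ℂ) * besselJ m ((ω * x : ℝ) : ℂ)) := by
  have hw := intervalIntegrable_rpow_mul_besselJ hm hαm hω hb.le
  have hp : ContinuousOn (fun x : ℝ => (interp b N f).eval (x : ℂ)) (uIcc 0 b) :=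
    ((Polynomial.continuous _).comp continuous_ofReal).continuousOn
  have h1 := hw.continuousOn_mul (g := f) (by rwa [uIcc_of_le hb.le])
  have h2 := hw.continuousOn_mul hp
  have hcomm : ∀ a c d : ℂ, a * c * d = c * (a * d) := fun a c d => by ring
  simp only [besselTransform, ccfRule, hcomm]
  rw [← intervalIntegral.integral_sub h1 h2]
  simp only [errDeriv_zero_apply, sub_mul]

theorem C₁_mono {c d : ℝ} (h : c ≤ d) (α : ℝ) {ω : ℝ} (hω : 0 < ω) : C₁ c α ω ≤ C₁ d α ω := by
  unfold C₁
  split_ifs <;> gcongr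

end CCF

/-! ### Assembly of the three bounds. -/

theorem theorem3p1 (b α : ℝ) (m : ℂ) (hb : 0 < b) (hα : -1 < α)
    (hm : -1 < m.re) (hαm : -1 < α + m.re) :
    ∃ c : ℝ, 0 < c ∧ ∀ (N : ℕ) (ω : ℝ) (f : ℝ → ℂ), 1 ≤ N → 1 ≤ ω →
      ContDiffOn ℝ 2 f (Set.Icc 0 b) →
        (m.im = 0 → 0 ≤ m.re →
          ‖CCF.besselTransform b α m ω f - CCF.ccfRule b α m ω N f‖ ≤
            min (CCF.bound₁ b α N f)
              (min (CCF.bound₂ c b α ω N f) (CCF.bound₃ c b α m ω N f))) ∧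
        ‖CCF.besselTransform b α m ω f - CCF.ccfRule b α m ω N f‖ ≤
          min (CCF.bound₂ c b α ω N f) (CCF.bound₃ c b α m ω N f) := by
  have hm1 : -1 < (m + 1).re := by simp; linarith
  have hαm1 : -1 < α + (m + 1).re := by simp; linarith
  obtain ⟨c, hc0, hc⟩ := CCF.exists_norm_integral_le_C₁ b hm hαm
  obtain ⟨d, hd0, hd⟩ := CCF.exists_norm_integral_le_C₁ b hm1 hαm1
  -- `c` controls the primitive for order `m` (B₂), `d` that for order `m+1` (B₃); the `1` secures
  -- positivity.
  refine ⟨c + d + 1, by positivity, fun N ω f hN hω hf => ?_⟩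
  have hω0 : 0 < ω := zero_lt_one.trans_le hω
  have hc' := fun x hx => (hc ω hω x hx).trans (CCF.C₁_mono (by linarith : c ≤ c + d + 1) α hω0)
  have hd' := fun x hx => (hd ω hω x hx).trans (CCF.C₁_mono (by linarith : d ≤ c + d + 1) α hω0)
  have hcont := fun j (hj : j ≤ 2) => CCF.continuousOn_errDeriv hb N hf hj
  have hsup := fun j (hj : j ≤ 2) x (hx : x ∈ Set.Icc 0 b) =>
    CCF.norm_le_supNorm (hcont j hj) hx
  have he : ∀ x ∈ Set.Icc 0 b, HasDerivWithinAt (CCF.errDeriv b N f 0) (CCF.errDeriv b N f 1 x)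
      (Set.Icc 0 b) x := fun x hx => CCF.hasDerivWithinAt_errDeriv hb N hf (by norm_num) hx
  have he₁ : ∀ x ∈ Set.Icc 0 b, HasDerivWithinAt (CCF.errDeriv b N f 1) (CCF.errDeriv b N f 2 x)
      (Set.Icc 0 b) x := fun x hx => CCF.hasDerivWithinAt_errDeriv hb N hf (by norm_num) hx
  have h0 := CCF.errDeriv_zero_left hb hN f
  have hbe := CCF.errDeriv_zero_right hb hN f
  have hC0 : 0 ≤ CCF.C₁ (c + d + 1) α ω := (norm_nonneg _).trans (hc' 0 ⟨le_rfl, hb.le⟩)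
  rw [CCF.besselTransform_sub_ccfRule hb hm hαm N hω0 hf.continuousOn]
  have hB₂ := CCF.norm_integral_rpow_mul_besselJ_le_deriv hb hm hαm hω0 hc' (hcont 0 (by norm_num))
    (fun x hx => (he x (Set.Ioo_subset_Icc_self hx)).hasDerivAt (Icc_mem_nhds hx.1 hx.2))
    ((hcont 1 (by norm_num)).mono Set.Ioo_subset_Icc_self)
    (fun x hx => hsup 1 (by norm_num) x (Set.Ioo_subset_Icc_self hx))
  have hB₃ := CCF.norm_integral_rpow_mul_besselJ_le_second_deriv hb hm hαm hω0 hd' h0 hbe he he₁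
    (hcont 2 le_rfl) (hsup 2 le_rfl)
  rw [hbe, norm_zero, zero_add] at hB₂
  have hS : 0 ≤ CCF.supNorm b (CCF.errDeriv b N f 2) :=
    (norm_nonneg _).trans (hsup 2 le_rfl 0 ⟨le_rfl, hb.le⟩)
  have hmain := le_min (hB₂.trans_eq (by rw [CCF.bound₂]; ring) :
      _ ≤ CCF.bound₂ (c + d + 1) b α ω N f)
    -- The argument gives the factor `1 + |α-m-1|`, which is below the stated `1 + (3/2)|α-m-1|`.
    (hB₃.trans (by
      rw [CCF.bound₃, ← mul_assoc b]
      have := norm_nonneg ((α : ℂ) - m - 1)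
      gcongr
      linarith) : _ ≤ CCF.bound₃ (c + d + 1) b α m ω N f)
  refine ⟨fun him hre => le_min ?_ hmain, hmain⟩
  obtain ⟨ν, rfl⟩ : ∃ ν : ℝ, (ν : ℂ) = m := ⟨m.re, Complex.ext rfl him.symm⟩
  exact CCF.norm_integral_rpow_mul_besselJ_le_sup hb hα hre hω0 (hsup 0 (by norm_num))
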